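/- Let $k\ge 1$ be a fixed integer. A $k$-CNF formula $\mathbf F$ on $n$ variables is a list of $m$ clauses, each a list of at most $k$ literals; $\Omega_{\mathbf F}\subseteq\{0,1\}^n$ is its set of satisfying assignments, $d_H$ is the Hamming distance, and, when $\Omega_{\mathbf F}\neq\emptyset$, $\mathrm{Diam}(\mathbf F)=\max_{z_1,z_2\in\Omega_{\mathbf F}} d_H(z_1,z_2)$. There is a randomized algorithm (depending only on $k$), a polynomial $p$ (depending only on $k$) and a function $\varepsilon:\mathbb N\to\mathbb R$ with $\varepsilon(n)\to 0$ as $n\to\infty$ (depending only on $k$), such that for every $n$ and every $k$-CNF formula $\mathbf F$ on $n$ variables with $m$ clauses, given $\mathbf F$ as input: 1. the algorithm always halts (for all outcomes of its coin tosses, and whether or not $\mathbf F$ is satisfiable) after at most $p(n+m)\cdot 2^{n(1-1/k)}$ steps, i.e. it runs in time $O^*\bigl(2^{n(1-1/k)}\bigr)$; 2. if $\mathbf F$ is satisfiable, then with probability at least $1-\varepsilon(n)$ it outputs $z_1^*,z_2^*\in\Omega_{\mathbf F}$ with $$d_H(z_1^*,z_2^*)\;\ge\;\tfrac12\Bigl(1-\tfrac1k\Bigr)\,\mathrm{Diam}(\mathbf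 F).$$ Here an algorithm is a randomized WHILE program on list structures (binary trees, with the operations cons, head, tail and the test for nil, and fair coin tosses), and every executed command counts as one step. -/

import Mathlib

open Filter Topology
open scoped ENNReal

/-! ### Satisfying assignments and the diameter of a CNF formula

A formula on `n` variables is a `Std.Sat.CNF (Fin n)`: an array of clauses, a clause being a list of
literals `(i, b)`, and the literal `(i, b)` being satisfied by `z : Fin n → Bool` iff `z i = b`. -/

namespace KSat

/-- Every clause has at most `k` literals. -/
def IsKCNF {n : ℕ} (k : ℕ) (F : Std.Sat.CNF (Fin n)) : Prop :=
  ∀ C ∈ F.clauses, C.length ≤ k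

/-- The set of satisfying assignments of `F`. -/
def solutions {n : ℕ} (F : Std.Sat.CNF (Fin n)) : Finset (Fin n → Bool) :=
  Finset.univ.filter fun z => F.eval z = true

/-- The largest Hamming distance between two satisfying assignments; it is `⊥` iff `F` is
unsatisfiable. -/
def diam {n : ℕ} (F : Std.Sat.CNF (Fin n)) : WithBot ℕ :=
  ((solutions F ×ˢ solutions F).image fun p => hammingDist p.1 p.2).max

end KSat

/-! ### A machine model: randomized WHILE programs

Programs work on binary trees (list structures, "cons cells") held in finitely many registers.
Data are built and taken apart one cell at a time, there is no arithmetic and no equality test on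
trees, and the only source of randomness is a fair coin. One step executes one command; as an
assignment or a test evaluates an expression that is written out in the program, a step costs
a number of pointer operations that is bounded by a constant of the program. -/

namespace RandWhile

/-- Binary trees, the data of the programs. -/
inductive Val : Type
  | nil : Val
  | cons : Val → Val → Val

namespace Val

/-- The left component; the head of a list. -/
def hd : Val → Val
  | nil => nil
  | cons a _ => a

/-- The right component; the tail of a list. -/
def tl : Val → Val
  | nil => nil
  | cons _ b => b

/-- The test used by conditionals and loops: every tree but `nil` counts as true. -/
def isCons : Val → Bool
  | nil => false
  | cons _ _ => true

/-- Truth values as trees. -/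
def ofBool : Bool → Val
  | false => nil
  | true => cons nil nil

/-- A list of trees as a tree. -/
def ofList : List Val → Val
  | [] => nil
  | a :: l => cons a (ofList l)

/-- Natural numbers in unary. -/
def ofNat (n : ℕ) : Val := ofList (List.replicate n nil)

end Val

/-- The contents of the registers. -/
abbrev Store : Type := ℕ → Val

/-- Expressions. -/
inductive Expr : Type
  | var : ℕ → Expr
  | nil : Expr
  | cons : Expr → Expr → Expr
  | hd : Expr → Expr
  | tl : Expr → Expr

/-- The value of an expression. -/
def Expr.eval (s : Store) : Expr → Val
  | .var i => s i
  | .nil => .nil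
  | .cons a b => .cons (a.eval s) (b.eval s)
  | .hd a => (a.eval s).hd
  | .tl a => (a.eval s).tl

/-- Programs: `assign i e` stores the value of `e` in register `i`, `flip i` stores the outcome of
a fair coin toss in register `i`, `seq` is sequential composition, `ite` a conditional and `loop e c`
executes `c` as long as the value of `e` is not `nil`. -/
inductive Prog : Type
  | assign : ℕ → Expr → Prog
  | flip : ℕ → Prog
  | seq : Prog → Prog → Prog
  | ite : Expr → Prog → Prog → Prog
  | loop : Expr → Prog → Prog

/-- A configuration: the commands still to be executed, first one first, and the store. -/
structure Config : Type where
  todo : List Prog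
  store : Store

/-- One step of the computation. A configuration with nothing to do is final and stays as it is. -/
noncomputable def step : Config → PMF Config
  | ⟨[], s⟩ => PMF.pure ⟨[], s⟩
  | ⟨.assign i e :: K, s⟩ => PMF.pure ⟨K, Function.update s i (e.eval s)⟩
  | ⟨.flip i :: K, s⟩ =>
      (PMF.uniformOfFintype Bool).map fun b => ⟨K, Function.update s i (Val.ofBool b)⟩
  | ⟨.seq c d :: K, s⟩ => PMF.pure ⟨c :: d :: K, s⟩
  | ⟨.ite e c d :: K, s⟩ => PMF.pure ⟨(if (e.eval s).isCons then c else d) :: K, s⟩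
  | ⟨.loop e c :: K, s⟩ =>
      PMF.pure ⟨if (e.eval s).isCons then c :: .loop e c :: K else K, s⟩

/-- The distribution of the configuration after `t` steps. -/
noncomputable def run : ℕ → Config → PMF Config
  | 0, c => PMF.pure c
  | t + 1, c => (step c).bind (run t)

/-- The initial configuration: the input is in register `0`, the other registers hold `nil`. -/
def Prog.init (P : Prog) (x : Val) : Config :=
  ⟨[P], fun i => if i = 0 then x else Val.nil⟩

/-- On input `x`, the program halts within `T` steps, whatever the outcomes of the coin tosses. -/
def Prog.HaltsWithin (P : Prog) (x : Val) (T : ℕ) : Prop :=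
  ∀ c ∈ (run T (P.init x)).support, c.todo = []

/-- The probability that, on input `x`, the program halts within `T` steps with an output in `S`.
The output is the final content of register `0`. -/
noncomputable def Prog.outputProb (P : Prog) (x : Val) (T : ℕ) (S : Set Val) : ℝ≥0∞ :=
  (run T (P.init x)).toOuterMeasure {c | c.todo = [] ∧ c.store 0 ∈ S}

/-! ### Encoding of inputs and outputs -/

/-- A literal: the index of its variable in unary, and its sign. -/
def encodeLiteral {n : ℕ} (l : Fin n × Bool) : Val :=
  .cons (.ofNat l.1) (.ofBool l.2)

/-- A formula: the number of variables in unary, and the list of the clauses. -/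
def encodeFormula {n : ℕ} (F : Std.Sat.CNF (Fin n)) : Val :=
  .cons (.ofNat n)
    (.ofList (F.clauses.toList.map fun C => .ofList (C.map encodeLiteral)))

/-- An assignment: the list of its values. -/
def encodeAssignment {n : ℕ} (z : Fin n → Bool) : Val :=
  .ofList (List.ofFn fun i => .ofBool (z i))

/-- A pair of assignments. -/
def encodePair {n : ℕ} (z₁ z₂ : Fin n → Bool) : Val :=
  .cons (encodeAssignment z₁) (encodeAssignment z₂)

end RandWhile

/-! The algorithm repeats a Paturi–Pudlák–Zane trial about `(n + 1) * 2 ^ (n - n / k)` times. A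
trial runs through the variables in random order, gives each one a random value, and switches to the
other value if a clause becomes falsified. The first solution `u` that turns up is kept, together
with the solution farthest from `u` seen since. If that one is at least `(1 - 1/k)` times as far
from `u` as the farthest solution, the triangle inequality loses one more factor 2 against the
diameter (`far_half_diam`).

So it suffices that, for every fixed `u`, a single trial hits such a far solution with probability
of order `2 ^ (n/k - n)` (`le_prob_far`). Two estimates are multiplied here.

(a) A solution `y` with `I` isolated directions (flipping one of them leaves the solution set) is
output with probability at least `2 ^ (-n) * 2 ^ (I/k - k)` (`le_ppzPMF`). Each isolated direction
has a critical clause; if its variable comes last among the at most `k` variables of that clause,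
which has probability about `1/k`, the value is forced and costs no coin. Jensen's inequality moves
the expected number of forced variables into the exponent. The loss `2 ^ (-k)` pays for the shuffle
being only approximately uniform.

(b) The sum of `2 ^ (I(y)/k)` over the far solutions `y` is at least `2 ^ (n/k - 1)`
(`le_sum_isolation_far`). This refines the isoperimetric inequality behind the PPZ analysis: the
cube is split along a direction in which the farthest point is not isolated, and the induction
(`le_sum_isolation`) keeps track of how much distance may still be given up before the threshold is
reached.

The repetition is analysed by a potential with values 2, 1, 0 (nothing found, pair not yet far, pair
far) whose expectation shrinks by a constant factor in each trial (`expect_trialPMF_le`).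

The program is verified by a calculus of lower bounds: `Spec` and `Det` bound from below the
probability of halting in time with a good output, for an arbitrary continuation. This yields the
distribution of the outcome, and, with all outputs declared good, also halting on every coin
sequence (`main_correct`). -/

/-! ### Expectations with respect to a probability mass function -/

namespace PMF

variable {α β : Type}

/-- The expectation of a function with values in `[0, ∞]`. -/
noncomputable def expect (μ : PMF α) (g : α → ℝ≥0∞) : ℝ≥0∞ := ∑' a, μ a * g a

theorem expect_pure (a : α) (g : α → ℝ≥0∞) : (PMF.pure a).expect g = g a := by
  classical
  rw [expect, tsum_eq_single a]
  · simp
  · intro b hb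
    simp [PMF.pure_apply_of_ne _ _ hb]

theorem expect_bind (μ : PMF α) (κ : α → PMF β) (g : β → ℝ≥0∞) :
    (μ.bind κ).expect g = μ.expect fun a => (κ a).expect g := by
  simp only [expect, PMF.bind_apply, ← ENNReal.tsum_mul_right, ← ENNReal.tsum_mul_left]
  rw [ENNReal.tsum_comm]
  simp only [mul_assoc]

theorem expect_map (μ : PMF α) (f : α → β) (g : β → ℝ≥0∞) :
    (μ.map f).expect g = μ.expect fun a => g (f a) := by
  rw [← PMF.bind_pure_comp, expect_bind]
  simp only [Function.comp, expect_pure]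

theorem expect_mono (μ : PMF α) {g h : α → ℝ≥0∞} (hgh : ∀ a, g a ≤ h a) :
    μ.expect g ≤ μ.expect h :=
  ENNReal.tsum_le_tsum fun a => mul_le_mul_right (hgh a) (μ a)

theorem expect_const (μ : PMF α) (c : ℝ≥0∞) : (μ.expect fun _ => c) = c := by
  rw [expect, ENNReal.tsum_mul_right, μ.tsum_coe, one_mul]

theorem expect_add (μ : PMF α) (g h : α → ℝ≥0∞) :
    (μ.expect fun a => g a + h a) = μ.expect g + μ.expect h := by
  simp only [expect, mul_add, ENNReal.tsum_add]

theorem expect_const_mul (μ : PMF α) (c : ℝ≥0∞) (g : α → ℝ≥0∞) :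
    (μ.expect fun a => c * g a) = c * μ.expect g := by
  simp only [expect, ← ENNReal.tsum_mul_left]
  exact tsum_congr fun a => by ring

theorem expect_finset_sum {ι : Type} (μ : PMF α) (s : Finset ι) (g : ι → α → ℝ≥0∞) :
    (μ.expect fun a => ∑ i ∈ s, g i a) = ∑ i ∈ s, μ.expect (g i) := by
  classical
  induction s using Finset.induction_on with
  | empty => simp [expect]
  | insert i s hi ih => simp only [Finset.sum_insert hi, expect_add, ih]

theorem expect_uniform [Fintype α] [Nonempty α] (g : α → ℝ≥0∞) :
    (PMF.uniformOfFintype α).expect g = (Fintype.card α : ℝ≥0∞)⁻¹ * ∑ a, g a := by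
  simp [expect, PMF.uniformOfFintype_apply, tsum_fintype, Finset.mul_sum]

theorem expect_coin (g : Bool → ℝ≥0∞) :
    (PMF.uniformOfFintype Bool).expect g = 2⁻¹ * (g true + g false) := by
  simp [expect_uniform]

/-- Running through a list, a random step for each of its entries. -/
noncomputable def foldl {ξ : Type} (κ : ξ → α → PMF α) : List ξ → α → PMF α
  | [], a => PMF.pure a
  | x :: l, a => (κ x a).bind (foldl κ l)

/-- With identical steps the last one can be split off instead of the first; the rounds of the
shuffle are analysed in this order. -/
theorem foldl_const_succ {ξ : Type} (κ : α → PMF α) (x : ξ) (l : List ξ) (a : α) :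
    foldl (fun _ : ξ => κ) (x :: l) a = (foldl (fun _ : ξ => κ) l a).bind κ := by
  induction l generalizing x a with
  | nil =>
    simp only [foldl]
    rw [PMF.pure_bind]
    exact PMF.bind_pure _
  | cons y l ih =>
    rw [foldl]
    conv_lhs => enter [2, a']; rw [ih y a']
    rw [← PMF.bind_bind]
    rfl

end PMF

namespace RandWhile

open PMF (expect)

/-! ### Program logic -/

/-- The probability that the computation from `c` halts within `t` steps with output in `S`. -/
noncomputable def haltProb (S : Set Val) (t : ℕ) (c : Config) : ℝ≥0∞ :=
  (run t c).toOuterMeasure {c | c.todo = [] ∧ c.store 0 ∈ S}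

theorem haltProb_zero (S : Set Val) (c : Config) [Decidable (c.todo = [] ∧ c.store 0 ∈ S)] :
    haltProb S 0 c = if c.todo = [] ∧ c.store 0 ∈ S then 1 else 0 := by
  classical
  rw [haltProb, run, PMF.toOuterMeasure_pure_apply]
  split_ifs <;> simp_all

theorem haltProb_succ (S : Set Val) (t : ℕ) (c : Config) :
    haltProb S (t + 1) c = (step c).expect (haltProb S t) := by
  simp only [haltProb, run, PMF.toOuterMeasure_bind_apply, expect]

/-- Final configurations are fixed by `step`. Hence time bounds may be relaxed freely in the program
logic. -/
theorem haltProb_le_succ (S : Set Val) (t : ℕ) (c : Config) :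
    haltProb S t c ≤ haltProb S (t + 1) c := by
  classical
  induction t generalizing c with
  | zero =>
    rw [haltProb_succ, haltProb_zero]
    split_ifs with h
    · obtain ⟨K, s⟩ := c
      obtain ⟨rfl, h⟩ := h
      rw [step, PMF.expect_pure, haltProb_zero, if_pos ⟨rfl, h⟩]
    · exact zero_le
  | succ t ih =>
    rw [haltProb_succ, haltProb_succ S (t + 1)]
    exact PMF.expect_mono _ fun c => ih c

theorem haltProb_mono (S : Set Val) {t t' : ℕ} (h : t ≤ t') (c : Config) :
    haltProb S t c ≤ haltProb S t' c :=
  monotone_nat_of_le_succ (fun t => haltProb_le_succ S t c) h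

/-- From the store `s`, the program `P` halts within `T` steps in a store that represents, in the
sense of `R`, a random value with distribution `μ`. -/
def Spec {α : Type} (P : Prog) (s : Store) (T : ℕ) (μ : PMF α) (R : α → Store → Prop) : Prop :=
  ∀ (S : Set Val) (K : List Prog) (t : ℕ) (g : α → ℝ≥0∞),
    (∀ a s', R a s' → g a ≤ haltProb S t ⟨K, s'⟩) → μ.expect g ≤ haltProb S (t + T) ⟨P :: K, s⟩

/-- From the store `s`, the program `P` halts within `T` steps in a store that satisfies `R`. -/
def Det (P : Prog) (s : Store) (T : ℕ) (R : Store → Prop) : Prop :=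
  ∀ (S : Set Val) (K : List Prog) (t : ℕ) (v : ℝ≥0∞),
    (∀ s', R s' → v ≤ haltProb S t ⟨K, s'⟩) → v ≤ haltProb S (t + T) ⟨P :: K, s⟩

section Rules

variable {α β : Type} {P Q : Prog} {s : Store} {T T' : ℕ} {μ : PMF α} {R : α → Store → Prop}

theorem Spec.weaken {R' : α → Store → Prop} (h : Spec P s T μ R) (hT : T ≤ T')
    (hR : ∀ a s', R a s' → R' a s') : Spec P s T' μ R' := fun S K t g hg =>
  (h S K t g fun a s' ha => hg a s' (hR a s' ha)).trans
    (haltProb_mono S (by omega) _)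

theorem Det.weaken {R R' : Store → Prop} (h : Det P s T R) (hT : T ≤ T')
    (hR : ∀ s', R s' → R' s') : Det P s T' R' := fun S K t g hg =>
  (h S K t g fun s' ha => hg s' (hR s' ha)).trans (haltProb_mono S (by omega) _)

theorem Spec.map {f : β → α} {μ : PMF β} (h : Spec P s T μ fun b => R (f b)) :
    Spec P s T (μ.map f) R := fun S K t g hg => by
  rw [PMF.expect_map]
  exact h S K t _ fun b s' hb => hg (f b) s' hb

theorem Spec.flip (i : ℕ) (s : Store) :
    Spec (.flip i) s 1 (PMF.uniformOfFintype Bool)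
      fun b s' => s' = Function.update s i (Val.ofBool b) := fun S K t g hg => by
  rw [haltProb_succ, step, PMF.expect_map]
  exact PMF.expect_mono _ fun b => hg b _ rfl

/-- Composition works because `Spec` quantifies over the commands still to be executed: the second
program is simply put in front of the continuation of the first. -/
theorem Spec.seq {ν : α → PMF β} {R' : β → Store → Prop} (h : Spec P s T μ R)
    (h' : ∀ a s', R a s' → Spec Q s' T' (ν a) R') :
    Spec (.seq P Q) s (T + T' + 1) (μ.bind ν) R' := fun S K t g hg => by
  rw [← add_assoc, haltProb_succ, step, PMF.expect_pure, PMF.expect_bind,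
    show t + (T + T') = t + T' + T by ring]
  exact h S _ _ _ fun a s' ha => h' a s' ha S K t g hg

theorem Det.seq_spec {R : Store → Prop} {R' : α → Store → Prop} (h : Det P s T R)
    (h' : ∀ s', R s' → Spec Q s' T' μ R') : Spec (.seq P Q) s (T + T' + 1) μ R' :=
  fun S K t g hg => by
  rw [← add_assoc, haltProb_succ, step, PMF.expect_pure, show t + (T + T') = t + T' + T by ring]
  exact h S _ _ _ fun s' ha => h' s' ha S K t g hg

theorem Spec.seq_det {R' : α → Store → Prop} (h : Spec P s T μ R)
    (h' : ∀ a s', R a s' → Det Q s' T' (R' a)) : Spec (.seq P Q) s (T + T' + 1) μ R' :=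
  fun S K t g hg => by
  rw [← add_assoc, haltProb_succ, step, PMF.expect_pure, show t + (T + T') = t + T' + T by ring]
  exact h S _ _ _ fun a s' ha => h' a s' ha S K t _ fun s'' h'' => hg a s'' h''

theorem Det.seq {R R' : Store → Prop} (h : Det P s T R) (h' : ∀ s', R s' → Det Q s' T' R') :
    Det (.seq P Q) s (T + T' + 1) R' := fun S K t v hv => by
  rw [← add_assoc, haltProb_succ, step, PMF.expect_pure, show t + (T + T') = t + T' + T by ring]
  exact h S _ _ _ fun s' ha => h' s' ha S K t v hv

theorem Det.assign {i : ℕ} {e : Expr} {R : Store → Prop}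
    (h : R (Function.update s i (e.eval s))) : Det (.assign i e) s 1 R := fun S K t v hv => by
  rw [haltProb_succ, step, PMF.expect_pure]
  exact hv _ h

theorem Det.assign_seq {i : ℕ} {e : Expr} {R : Store → Prop}
    (h : Det Q (Function.update s i (e.eval s)) T R) :
    Det (.seq (.assign i e) Q) s (T + 2) R :=
  (Det.seq (T := 1) (R := fun s' => s' = Function.update s i (e.eval s)) (Det.assign rfl)
    fun s' hs' => by subst hs'; exact h).weaken (by omega) fun _ h => h

theorem Spec.assign_seq {i : ℕ} {e : Expr}
    (h : Spec Q (Function.update s i (e.eval s)) T μ R) :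
    Spec (.seq (.assign i e) Q) s (T + 2) μ R :=
  (Det.seq_spec (T := 1) (R := fun s' => s' = Function.update s i (e.eval s)) (Det.assign rfl)
    fun s' hs' => by subst hs'; exact h).weaken (by omega) fun _ _ h => h

theorem Det.ite {e : Expr} {R : Store → Prop}
    (h : Det (if (e.eval s).isCons then P else Q) s T R) : Det (.ite e P Q) s (T + 1) R :=
  fun S K t v hv => by
  rw [← add_assoc, haltProb_succ, step, PMF.expect_pure]
  exact h S K t v hv

/-- The rule for loops that run through a list. -/
theorem Spec.loop {ξ : Type} {e : Expr} (κ : ξ → α → PMF α) (Inv : List ξ → α → Store → Prop)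
    (hnil : ∀ a s, Inv [] a s → (e.eval s).isCons = false)
    (hcons : ∀ x l a s, Inv (x :: l) a s →
      (e.eval s).isCons = true ∧ Spec P s T (κ x a) (Inv l))
    (l : List ξ) (a : α) (s : Store) (h : Inv l a s) :
    Spec (.loop e P) s (l.length * (T + 1) + 1) (PMF.foldl κ l a) (Inv []) := by
  induction l generalizing a s with
  | nil =>
    intro S K t g hg
    rw [PMF.foldl, PMF.expect_pure, List.length_nil, Nat.zero_mul, zero_add, haltProb_succ, step,
      PMF.expect_pure, hnil a s h]
    exact hg a s h
  | cons x l ih =>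
    intro S K t g hg
    obtain ⟨h1, h2⟩ := hcons x l a s h
    rw [PMF.foldl, List.length_cons,
      show t + ((l.length + 1) * (T + 1) + 1) = t + (l.length * (T + 1) + 1) + T + 1 by ring,
      haltProb_succ, step, PMF.expect_pure, h1, if_pos rfl, PMF.expect_bind]
    exact h2 S _ _ _ fun a' s' h' => ih a' s' h' S K t g hg

/-- The rule for deterministic loops that run through a list. -/
theorem Det.loop {ξ : Type} {e : Expr} (f : α → ξ → α) (Inv : List ξ → α → Store → Prop)
    (hnil : ∀ a s, Inv [] a s → (e.eval s).isCons = false)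
    (hcons : ∀ x l a s, Inv (x :: l) a s →
      (e.eval s).isCons = true ∧ Det P s T (Inv l (f a x)))
    (l : List ξ) (a : α) (s : Store) (h : Inv l a s) :
    Det (.loop e P) s (l.length * (T + 1) + 1) (Inv [] (l.foldl f a)) := by
  induction l generalizing a s with
  | nil =>
    intro S K t v hv
    rw [List.length_nil, Nat.zero_mul, zero_add, haltProb_succ, step,
      PMF.expect_pure, hnil a s h]
    exact hv s h
  | cons x l ih =>
    intro S K t v hv
    obtain ⟨h1, h2⟩ := hcons x l a s h
    rw [List.length_cons,
      show t + ((l.length + 1) * (T + 1) + 1) = t + (l.length * (T + 1) + 1) + T + 1 by ring,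
      haltProb_succ, step, PMF.expect_pure, h1, if_pos rfl]
    exact h2 S _ _ _ fun s' h' => ih (f a x) s' h' S K t v hv

end Rules

/-- The commands of a list, one after the other. -/
def block : List Prog → Prog
  | [] => .assign 2 (.var 2)
  | [P] => P
  | P :: Q :: L => .seq P (block (Q :: L))

/-- Registers outside `X` are unchanged. -/
def Frame (X : List ℕ) (s s' : Store) : Prop := ∀ i, i ∉ X → s' i = s i

end RandWhile

namespace RandWhile

/-! ### Frames -/

theorem Frame.refl (X : List ℕ) (s : Store) : Frame X s s := fun _ _ => rfl

theorem Frame.update {X : List ℕ} {s s' : Store} (h : Frame X s s') {i : ℕ} (hi : i ∈ X)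
    (v : Val) : Frame X s (Function.update s' i v) := fun j hj => by
  rw [Function.update_of_ne (by rintro rfl; exact hj hi)]
  exact h j hj

theorem Frame.trans {X Y Z : List ℕ} {s s' s'' : Store} (h : Frame X s s') (h' : Frame Y s' s'')
    (hX : X ⊆ Z) (hY : Y ⊆ Z) : Frame Z s s'' := fun i hi =>
  (h' i fun h => hi (hY h)).trans (h i fun h => hi (hX h))

/-! ### Values -/

@[simp] theorem Val.hd_nil : Val.nil.hd = .nil := rfl
@[simp] theorem Val.tl_nil : Val.nil.tl = .nil := rfl
@[simp] theorem Val.hd_cons (a b : Val) : (Val.cons a b).hd = a := rfl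
@[simp] theorem Val.tl_cons (a b : Val) : (Val.cons a b).tl = b := rfl
@[simp] theorem Val.isCons_nil : Val.nil.isCons = false := rfl
@[simp] theorem Val.isCons_cons (a b : Val) : (Val.cons a b).isCons = true := rfl
@[simp] theorem Val.isCons_ofBool (b : Bool) : (Val.ofBool b).isCons = b := by cases b <;> rfl
@[simp] theorem Val.ofList_nil : Val.ofList [] = .nil := rfl
@[simp] theorem Val.ofList_cons (a : Val) (l : List Val) :
    Val.ofList (a :: l) = .cons a (.ofList l) := rfl

theorem Val.tl_ofList (l : List Val) : (Val.ofList l).tl = Val.ofList l.tail := by cases l <;> rfl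
theorem Val.hd_ofList (l : List Val) : (Val.ofList l).hd = l.headD .nil := by cases l <;> rfl

theorem Val.ofNat_succ (n : ℕ) : Val.ofNat (n + 1) = .cons .nil (.ofNat n) := rfl

/-- The command without effect. -/
def skip : Prog := .assign 2 (.var 2)

theorem Det.skip {s : Store} {R : Store → Prop} (h : R s) : Det skip s 1 R :=
  Det.assign (by simpa [Expr.eval] using h)

/-! ### Moving a list -/

/-- Push the entries of the list in register `r` on the list in register `q`. -/
def moveList (r q : ℕ) : Prog :=
  .loop (.var r) (block [.assign q (.cons (.hd (.var r)) (.var q)), .assign r (.tl (.var r))])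

theorem det_moveList {r q : ℕ} (hrq : r ≠ q) {s : Store} {l acc : List Val}
    (hr : s r = Val.ofList l) (hq : s q = Val.ofList acc) :
    Det (moveList r q) s (4 * l.length + 1) fun s' =>
      s' q = Val.ofList (l.reverse ++ acc) ∧ Frame [r, q] s s' := by
  refine (Det.loop (T := 3) (fun a x => x :: a)
    (fun l a s' => s' r = Val.ofList l ∧ s' q = Val.ofList a ∧ Frame [r, q] s s')
    ?_ ?_ l acc s ⟨hr, hq, Frame.refl _ _⟩).weaken (by omega) ?_
  · rintro a s' ⟨h, -, -⟩
    simp [Expr.eval, h]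
  · rintro x l a s' ⟨h1, h2, h3⟩
    refine ⟨by simp [Expr.eval, h1], Det.assign_seq (Det.assign ⟨?_, ?_, ?_⟩)⟩
    · simp [Expr.eval, hrq, h1]
    · simp [Expr.eval, hrq.symm, h1, h2]
    · exact (h3.update (by simp) _).update (by simp) _
  · rintro s' ⟨-, h2, h3⟩
    refine ⟨?_, h3⟩
    rw [h2]
    congr 1
    clear hr hq h2
    induction l generalizing acc with
    | nil => rfl
    | cons x l ih => simp [ih]

/-! ### Partial assignments -/

section Check

variable {n : ℕ}

/-- The value of a variable under a partial assignment. -/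
def encodeEntry : Option Bool → Val
  | none => .nil
  | some b => .cons (.ofBool b) (.ofBool (!b))

/-- A partial assignment: the list of its values. -/
def encodePartial (α : Fin n → Option Bool) : Val :=
  .ofList (List.ofFn fun i => encodeEntry (α i))

/-- The partial assignment `α` falsifies all literals of some clause of `F`. -/
def falsifies (F : Std.Sat.CNF (Fin n)) (α : Fin n → Option Bool) : Bool :=
  F.clauses.toList.any fun C => C.all fun l => α l.1 == some (!l.2)

/-- Walk down the list in register `10` by the number in register `9`. -/
def walk : Prog :=
  .loop (.var 9) (block [.assign 9 (.tl (.var 9)), .assign 10 (.tl (.var 10))])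

theorem det_walk {s : Store} {j : ℕ} {w : List Val}
    (h9 : s 9 = Val.ofNat j) (h10 : s 10 = Val.ofList w) :
    Det walk s (4 * j + 1) fun s' => s' 10 = Val.ofList (w.drop j) ∧ Frame [9, 10] s s' := by
  refine (Det.loop (T := 3) (fun (a : List Val) _ => a.tail)
    (fun l a s' => s' 9 = Val.ofList l ∧ s' 10 = Val.ofList a ∧ Frame [9, 10] s s')
    ?_ ?_ (List.replicate j .nil) w s ⟨h9, h10, Frame.refl _ _⟩).weaken (by simp; omega) ?_
  · rintro a s' ⟨h, -, -⟩
    simp [Expr.eval, h]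
  · rintro x l a s' ⟨h1, h2, h3⟩
    refine ⟨by simp [Expr.eval, h1], Det.assign_seq (Det.assign ⟨?_, ?_, ?_⟩)⟩
    · simp [Expr.eval, h1]
    · simp [Expr.eval, h2, Val.tl_ofList]
    · exact (h3.update (by simp) _).update (by simp) _
  · rintro s' ⟨-, h2, h3⟩
    refine ⟨?_, h3⟩
    rw [h2]
    congr 1
    clear h9 h10 h2
    induction j generalizing w with
    | zero => rfl
    | succ j ih => simp [List.replicate_succ, ih]

/-- Clear register `11` unless the first literal of register `8` is falsified. -/
def checkLiteral : Prog :=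
  block [.assign 9 (.hd (.hd (.var 8))), .assign 10 (.var 5), walk,
    .ite (.tl (.hd (.var 8)))
      (.ite (.tl (.hd (.var 10))) skip (.assign 11 .nil))
      (.ite (.hd (.hd (.var 10))) skip (.assign 11 .nil)),
    .assign 8 (.tl (.var 8))]

/-- An assigned entry stores the value and its negation, an unassigned one is `nil`. So a positive
literal is falsified iff the tail of the entry is a cons, a negative one iff the head is, and
unassigned variables fail both tests. -/
theorem det_checkLiteral {s : Store} {α : Fin n → Option Bool} {l : Fin n × Bool} {v : Val}
    {a : Bool} (h5 : s 5 = encodePartial α) (h8 : s 8 = .cons (encodeLiteral l) v)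
    (h11 : s 11 = Val.ofBool a) :
    Det checkLiteral s (4 * n + 20) fun s' => s' 8 = v ∧
      s' 11 = Val.ofBool (a && (α l.1 == some (!l.2))) ∧ Frame [8, 9, 10, 11] s s' := by
  have hl := l.1.2
  refine Det.weaken (Det.assign_seq <| Det.assign_seq <| Det.seq (T := 4 * n + 1) (T' := 6)
    (Det.weaken (det_walk (j := l.1) (w := List.ofFn fun i => encodeEntry (α i)) ?_ ?_)
      (by omega) fun _ h => h) ?_) (by omega) fun _ h => h
  · simp [Expr.eval, h8, encodeLiteral]
  · simp [Expr.eval, h5, encodePartial]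
  rintro s' ⟨h1, h2⟩
  have e5 : s' 5 = encodePartial α := by rw [h2 5 (by simp)]; simpa using h5
  have e8 : s' 8 = .cons (encodeLiteral l) v := by rw [h2 8 (by simp)]; simpa using h8
  have e11 : s' 11 = Val.ofBool a := by rw [h2 11 (by simp)]; simpa using h11
  have e10 : (s' 10).hd = encodeEntry (α l.1) := by
    rw [h1, Val.hd_ofList]
    simp [List.headD_eq_head?_getD]
  have hf : Frame [8, 9, 10, 11] s s' := Frame.trans (X := [8, 9, 10, 11])
    (((Frame.refl _ s).update (by simp) _).update (by simp) _) h2 (by simp) (by simp)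
  set R : Store → Prop := fun s'' => s'' 8 = s' 8 ∧
    s'' 11 = Val.ofBool (a && (α l.1 == some (!l.2))) ∧ Frame [8, 9, 10, 11] s s'' with hR
  have key : ∀ e : Expr, (e.eval s').isCons = (α l.1 == some (!l.2)) →
      Det (.ite e skip (.assign 11 .nil)) s' 2 R := by
    intro e he
    refine Det.ite ?_
    rw [he]
    split_ifs with h
    · exact Det.skip ⟨rfl, by rw [h, Bool.and_true]; exact e11, hf⟩
    · rw [Bool.not_eq_true] at h
      exact Det.assign ⟨by simp, by rw [h, Bool.and_false]; simp [Expr.eval, Val.ofBool],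
        hf.update (by simp) _⟩
  refine Det.weaken (Det.seq (T := 3) (T' := 1) (R := R) (Det.ite ?_)
    fun s'' h => Det.assign ⟨?_, ?_, ?_⟩) (by omega) fun _ h => h
  · have hs : ((Expr.tl (.hd (.var 8))).eval s').isCons = l.2 := by
      simp [Expr.eval, e8, encodeLiteral]
    rw [hs]
    split_ifs with h
    · refine key _ ?_
      rw [h, Expr.eval, Expr.eval, Expr.eval, e10]
      rcases α l.1 with _ | _ | _ <;> rfl
    · refine key _ ?_
      rw [Bool.not_eq_true] at h
      rw [h, Expr.eval, Expr.eval, Expr.eval, e10]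
      rcases α l.1 with _ | _ | _ <;> rfl
  · simp [Expr.eval, h.1, e8]
  · simpa using h.2.1
  · exact h.2.2.update (by simp) _

/-- Set register `6` to the truth value of `falsifies`. -/
def check : Prog :=
  block [.assign 6 .nil, .assign 7 (.tl (.var 0)),
    .loop (.var 7) (block [.assign 8 (.hd (.var 7)), .assign 7 (.tl (.var 7)),
      .assign 11 (.cons .nil .nil), .loop (.var 8) checkLiteral,
      .ite (.var 11) (.assign 6 (.cons .nil .nil)) skip])]

theorem det_checkClause {s : Store} {α : Fin n → Option Bool} {C : List (Fin n × Bool)}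
    (h5 : s 5 = encodePartial α) (h8 : s 8 = .ofList (C.map encodeLiteral))
    (h11 : s 11 = Val.ofBool true) :
    Det (.loop (.var 8) checkLiteral) s (C.length * (4 * n + 21) + 1) fun s' =>
      s' 11 = Val.ofBool (C.all fun l => α l.1 == some (!l.2)) ∧ Frame [8, 9, 10, 11] s s' := by
  refine (Det.loop (T := 4 * n + 20) (fun (a : Bool) l => a && (α l.1 == some (!l.2)))
    (fun l a s' => s' 8 = Val.ofList (l.map encodeLiteral) ∧ s' 11 = Val.ofBool a ∧
      Frame [8, 9, 10, 11] s s')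
    ?_ ?_ C true s ⟨h8, h11, Frame.refl _ _⟩).weaken (by simp) ?_
  · rintro a s' ⟨h, -, -⟩
    simp [Expr.eval, h]
  · rintro x l a s' ⟨h1, h2, h3⟩
    refine ⟨by simp [Expr.eval, h1], ?_⟩
    refine (det_checkLiteral (h5 ▸ h3 5 (by simp)) h1 h2).weaken le_rfl ?_
    rintro s'' ⟨g1, g2, g3⟩
    exact ⟨g1, g2, h3.trans g3 (by simp) (by simp)⟩
  · rintro s' ⟨-, h2, h3⟩
    refine ⟨?_, h3⟩
    rw [h2]
    have : ∀ a : Bool, C.foldl (fun (a : Bool) l => a && (α l.1 == some (!l.2))) a =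
        (a && C.all fun l => α l.1 == some (!l.2)) := by
      clear h8 h2
      induction C with
      | nil => simp
      | cons x l ih => intro a; rw [List.foldl_cons, ih, List.all_cons, Bool.and_assoc]
    rw [this, Bool.true_and]

/-- A bound for the running time of `check`. -/
def checkTime (k n m : ℕ) : ℕ := m * (k * (4 * n + 21) + 20) + 20

theorem det_check {s : Store} {k : ℕ} {F : Std.Sat.CNF (Fin n)} {α : Fin n → Option Bool}
    (hF : KSat.IsKCNF k F) (h0 : s 0 = encodeFormula F) (h5 : s 5 = encodePartial α) :
    Det check s (checkTime k n F.clauses.size) fun s' =>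
      s' 6 = Val.ofBool (falsifies F α) ∧ Frame [6, 7, 8, 9, 10, 11] s s' := by
  have hF' : ∀ C ∈ F.clauses.toList, C.length ≤ k := fun C hC => hF C (by simpa using hC)
  refine Det.weaken (Det.assign_seq <| Det.assign_seq <|
    Det.loop (T := k * (4 * n + 21) + 19)
      (fun (a : Bool) (C : List (Fin n × Bool)) => a || C.all fun l => α l.1 == some (!l.2))
      (fun L a s' => s' 7 = Val.ofList (L.map fun C => .ofList (C.map encodeLiteral)) ∧
        s' 6 = Val.ofBool a ∧ (∀ C ∈ L, C.length ≤ k) ∧ Frame [6, 7, 8, 9, 10, 11] s s')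
      ?_ ?_ F.clauses.toList false _ ⟨?_, ?_, hF', ?_⟩) ?_ ?_
  · rintro a s' ⟨h, -, -⟩
    simp [Expr.eval, h]
  · rintro C L a s' ⟨h1, h2, h3, h4⟩
    refine ⟨by simp [Expr.eval, h1], ?_⟩
    have hC : C.length ≤ k := h3 C (by simp)
    have hC' : C.length * (4 * n + 21) ≤ k * (4 * n + 21) := Nat.mul_le_mul_right _ hC
    refine Det.weaken (Det.assign_seq <| Det.assign_seq <| Det.assign_seq <|
      Det.seq (T := k * (4 * n + 21) + 1) (T' := 2)
        (Det.weaken (det_checkClause (α := α) (C := C) ?_ ?_ ?_) (by omega) fun _ h => h) ?_)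
      (by omega) fun _ h => h
    · simpa using (h4 5 (by simp)).trans h5
    · simp [Expr.eval, h1]
    · simp [Expr.eval, Val.ofBool]
    · rintro s'' ⟨g1, g2⟩
      have e7 := g2 7 (by simp)
      have e6 := g2 6 (by simp)
      simp only [Function.update, Expr.eval, h1] at e7 e6
      simp at e7 e6
      have hf : Frame [6, 7, 8, 9, 10, 11] s s'' := Frame.trans (X := [6, 7, 8, 9, 10, 11])
        (((h4.update (by simp) _).update (by simp) _).update (by simp) _) g2 (by simp) (by simp)
      have h3' : ∀ C ∈ L, C.length ≤ k := fun C hC => h3 C (by simp [hC])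
      refine Det.ite ?_
      simp only [Expr.eval, g1, Val.isCons_ofBool]
      split_ifs with h
      · refine Det.assign ⟨by simpa using e7, ?_, h3', hf.update (by simp) _⟩
        rw [h]
        simp [Expr.eval, Val.ofBool]
      · refine Det.skip ⟨e7, ?_, h3', hf⟩
        rw [Bool.not_eq_true] at h
        rw [h, e6, h2, Bool.or_false]
  · simp [Expr.eval, h0, encodeFormula]
  · simp [Expr.eval, Val.ofBool]
  · exact ((Frame.refl _ s).update (by simp) _).update (by simp) _
  · simp [checkTime]
  · rintro s' ⟨-, h2, -, h3⟩
    refine ⟨?_, h3⟩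
    rw [h2]
    have : ∀ (L : List (List (Fin n × Bool))) (a : Bool),
        L.foldl (fun (a : Bool) (C : List (Fin n × Bool)) =>
          a || C.all fun l => α l.1 == some (!l.2)) a =
        (a || L.any fun C => C.all fun l => α l.1 == some (!l.2)) := by
      intro L
      induction L with
      | nil => simp
      | cons x l ih => intro a; rw [List.foldl_cons, ih, List.any_cons, Bool.or_assoc]
    rw [this, Bool.false_or]
    rfl

end Check

end RandWhile

namespace RandWhile

variable {n : ℕ}

/-! ### Assigning a variable -/

/-- Give the variable at the head of register `4` the value in register `2`. -/
def setVar : Prog :=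
  block [.assign 9 (.hd (.var 4)), .assign 10 (.var 5), .assign 12 .nil,
    .loop (.var 9) (block [.assign 9 (.tl (.var 9)), .assign 12 (.cons (.hd (.var 10)) (.var 12)),
      .assign 10 (.tl (.var 10))]),
    .ite (.var 2) (.assign 10 (.cons (.cons (.cons .nil .nil) .nil) (.tl (.var 10))))
      (.assign 10 (.cons (.cons .nil (.cons .nil .nil)) (.tl (.var 10)))),
    moveList 12 10, .assign 5 (.var 10)]

/-- The entries passed over are kept in reverse order, so that `moveList` can put them back after
the entry in between has been replaced. -/
theorem det_zip {s : Store} {j : ℕ} {w : List Val} (hj : j ≤ w.length)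
    (h9 : s 9 = Val.ofNat j) (h10 : s 10 = Val.ofList w) (h12 : s 12 = .nil) :
    Det (.loop (.var 9) (block [.assign 9 (.tl (.var 9)),
      .assign 12 (.cons (.hd (.var 10)) (.var 12)), .assign 10 (.tl (.var 10))])) s (6 * j + 1)
      fun s' => s' 10 = Val.ofList (w.drop j) ∧ s' 12 = Val.ofList (w.take j).reverse ∧
        Frame [9, 10, 12] s s' := by
  refine (Det.loop (T := 5) (fun (a : List Val × List Val) (_ : Unit) =>
      (a.1.tail, a.1.headD .nil :: a.2))
    (fun l a s' => s' 9 = Val.ofNat l.length ∧ s' 10 = Val.ofList a.1 ∧ s' 12 = Val.ofList a.2 ∧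
      Frame [9, 10, 12] s s')
    ?_ ?_ (List.replicate j ()) (w, []) s ⟨by simpa using h9, h10, h12, Frame.refl _ _⟩).weaken
      (by simp; omega) ?_
  · rintro a s' ⟨h, -, -⟩
    simp [Expr.eval, h, Val.ofNat]
  · rintro x l a s' ⟨h1, h2, h3, h4⟩
    rw [List.length_cons, Val.ofNat_succ] at h1
    refine ⟨by simp [Expr.eval, h1],
      Det.assign_seq (Det.assign_seq (Det.assign ⟨?_, ?_, ?_, ?_⟩))⟩
    · simp [Expr.eval, h1]
    · simp [Expr.eval, h2, Val.tl_ofList]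
    · simp [Expr.eval, h2, h3, Val.hd_ofList]
    · exact ((h4.update (by simp) _).update (by simp) _).update (by simp) _
  · rintro s' ⟨-, h2, h3, h4⟩
    have : ∀ acc : List Val, (List.replicate j ()).foldl
        (fun (a : List Val × List Val) (_ : Unit) => (a.1.tail, a.1.headD .nil :: a.2))
        (w, acc) = (w.drop j, (w.take j).reverse ++ acc) := by
      clear h9 h10 h2 h3
      induction j generalizing w with
      | zero => simp
      | succ j ih =>
        intro acc
        obtain _ | ⟨x, w⟩ := w
        · simp at hj
        · simpa [List.replicate_succ] using ih (w := w) (by simpa using hj) (x :: acc)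
    rw [this] at h2 h3
    exact ⟨h2, by simpa using h3, h4⟩

theorem encodePartial_update (α : Fin n → Option Bool) (x : Fin n) (b : Bool) :
    encodePartial (Function.update α x (some b)) =
      .ofList (((List.ofFn fun i => encodeEntry (α i)).take x) ++ encodeEntry (some b) ::
        ((List.ofFn fun i => encodeEntry (α i)).drop (x + 1))) := by
  rw [encodePartial]
  congr 1
  rw [← List.set_eq_take_cons_drop _ (by simp)]
  refine List.ext_getElem (by simp) fun i h1 h2 => ?_
  simp only [List.getElem_ofFn, List.getElem_set, Function.update_apply, Fin.ext_iff]
  by_cases h : i = x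
  · simp [h]
  · simp [h, Ne.symm h]

theorem det_setVar {s : Store} {α : Fin n → Option Bool} {x : Fin n} {b : Bool}
    (h4 : (s 4).hd = .ofNat x) (h2 : s 2 = .ofBool b) (h5 : s 5 = encodePartial α) :
    Det setVar s (10 * n + 30) fun s' =>
      s' 5 = encodePartial (Function.update α x (some b)) ∧ Frame [5, 9, 10, 12] s s' := by
  have hx := x.2
  set w := List.ofFn fun i => encodeEntry (α i) with hw
  have hwl : w.length = n := by simp [w]
  refine Det.weaken (Det.assign_seq <| Det.assign_seq <| Det.assign_seq <|
    Det.seq (T := 6 * n + 1) (T' := 4 * n + 10)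
    (Det.weaken (det_zip (j := x) (w := w) (by omega) ?_ ?_ ?_) (by omega) fun _ h => h) ?_)
    (by omega) fun _ h => h
  · simp [Expr.eval, h4]
  · simp [Expr.eval, h5, encodePartial, w]
  · simp [Expr.eval]
  rintro s' ⟨g10, g12, gf⟩
  have e2 : s' 2 = .ofBool b := by rw [gf 2 (by simp)]; simpa using h2
  have hf : Frame [5, 9, 10, 12] s s' := Frame.trans (X := [5, 9, 10, 12])
    ((((Frame.refl _ s).update (by simp) _).update (by simp) _).update (by simp) _) gf
    (by simp) (by simp)
  refine Det.weaken (Det.seq (T := 2) (T' := 4 * n + 4) (R := fun s'' =>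
    s'' 10 = .ofList (encodeEntry (some b) :: w.drop (x + 1)) ∧
    s'' 12 = Val.ofList (w.take x).reverse ∧ Frame [5, 9, 10, 12] s s'') ?_ ?_)
    (by omega) fun _ h => h
  · refine Det.ite ?_
    simp only [Expr.eval, e2, Val.isCons_ofBool]
    split_ifs with h
    · refine Det.assign ⟨?_, ?_, hf.update (by simp) _⟩
      · simp [Expr.eval, g10, Val.tl_ofList, h, encodeEntry, Val.ofBool]
      · simpa using g12
    · refine Det.assign ⟨?_, ?_, hf.update (by simp) _⟩
      · simp [Expr.eval, g10, Val.tl_ofList, h, encodeEntry, Val.ofBool]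
      · simpa using g12
  · rintro s'' ⟨g1, g2, g3⟩
    refine Det.weaken (Det.seq (T := 4 * n + 1) (T' := 1)
      (Det.weaken (det_moveList (by simp) g2 g1) (by simp) fun _ h => h) ?_)
      (by omega) fun _ h => h
    rintro t ⟨k1, k2⟩
    refine Det.assign ⟨?_, ?_⟩
    · rw [encodePartial_update]
      simpa [Expr.eval] using k1
    · exact (g3.trans k2 (by simp) (by simp)).update (by simp) _

/-- Assign a random value to `x`, unless this falsifies a clause: then assign the other value. -/
noncomputable def assignPMF (F : Std.Sat.CNF (Fin n)) (x : Fin n) (α : Fin n → Option Bool) :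
    PMF (Fin n → Option Bool) :=
  (PMF.uniformOfFintype Bool).map fun b =>
    if falsifies F (Function.update α x (some b)) then Function.update α x (some (!b))
    else Function.update α x (some b)

/-- The program for `assignPMF`, the variable being the first one in register `4`. -/
def assignVar : Prog :=
  block [.flip 2, setVar, check,
    .ite (.var 6) (block [.ite (.var 2) (.assign 2 .nil) (.assign 2 (.cons .nil .nil)), setVar])
      skip,
    .assign 4 (.tl (.var 4))]

/-- A bound for the running time of `assignVar`. -/
def assignTime (k n m : ℕ) : ℕ := checkTime k n m + 20 * n + 100

theorem spec_assignVar {s : Store} {k : ℕ} {F : Std.Sat.CNF (Fin n)} {α : Fin n → Option Bool}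
    {x : Fin n} {v : Val} (hF : KSat.IsKCNF k F) (h0 : s 0 = encodeFormula F)
    (h4 : s 4 = .cons (.ofNat x) v) (h5 : s 5 = encodePartial α) :
    Spec assignVar s (assignTime k n F.clauses.size) (assignPMF F x α) fun α' s' =>
      s' 4 = v ∧ s' 5 = encodePartial α' ∧ (∃ b, α' = Function.update α x (some b)) ∧
        Frame [2, 4, 5, 6, 7, 8, 9, 10, 11, 12] s s' := by
  set c := checkTime k n F.clauses.size with hc
  refine Spec.map ?_
  refine Spec.weaken (Spec.seq_det (T' := c + 20 * n + 90) (Spec.flip 2 s) ?_)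
    (by simp only [assignTime]; omega) fun _ _ h => h
  rintro b _ rfl
  refine Det.weaken (Det.seq (T := 10 * n + 30) (T' := c + 10 * n + 50)
    (det_setVar (α := α) (x := x) (b := b) (by simp [h4]) (by simp) (by simpa using h5)) ?_)
    (by omega) fun _ h => h
  rintro s1 ⟨g5, gf⟩
  have hf1 : Frame [2, 4, 5, 6, 7, 8, 9, 10, 11, 12] s s1 :=
    Frame.trans (X := [2]) ((Frame.refl _ s).update (by simp) _) gf (by simp) (by simp)
  have g4 : s1 4 = .cons (.ofNat x) v := by rw [gf 4 (by simp)]; simpa using h4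
  have g2 : s1 2 = .ofBool b := by rw [gf 2 (by simp)]; simp
  refine Det.weaken (Det.seq (T := c) (T' := 10 * n + 45)
    (det_check (α := Function.update α x (some b)) hF ?_ g5) ?_) (by omega) fun _ h => h
  · rw [hf1 0 (by simp), h0]
  rintro s2 ⟨k6, kf⟩
  have hf2 := hf1.trans kf (Z := [2, 4, 5, 6, 7, 8, 9, 10, 11, 12]) (by simp) (by simp)
  have k4 := (kf 4 (by simp)).trans g4
  have k2 := (kf 2 (by simp)).trans g2
  have k5 := (kf 5 (by simp)).trans g5
  refine Det.weaken (Det.seq (T := 10 * n + 40) (T' := 1)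
    (R := fun s' => s' 4 = .cons (.ofNat x) v ∧ s' 5 = encodePartial
      (if falsifies F (Function.update α x (some b)) then Function.update α x (some (!b))
        else Function.update α x (some b)) ∧ Frame [2, 4, 5, 6, 7, 8, 9, 10, 11, 12] s s')
    ?_ ?_) (by omega) fun _ h => h
  · refine Det.weaken (Det.ite (T := 10 * n + 33) ?_) (by omega) fun _ h => h
    simp only [Expr.eval, k6, Val.isCons_ofBool]
    split_ifs with h
    · refine Det.weaken (Det.seq (T := 2) (T' := 10 * n + 30)
        (R := fun s' => s' 2 = .ofBool (!b) ∧ Frame [2] s2 s') ?_ ?_) (by omega) fun _ h => h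
      · refine Det.ite ?_
        simp only [Expr.eval, k2, Val.isCons_ofBool]
        split_ifs with hb
        · exact Det.assign ⟨by simp [hb, Expr.eval, Val.ofBool],
            (Frame.refl _ _).update (by simp) _⟩
        · exact Det.assign ⟨by simp [hb, Expr.eval, Val.ofBool],
            (Frame.refl _ _).update (by simp) _⟩
      · rintro s3 ⟨l2, lf⟩
        refine (det_setVar (α := Function.update α x (some b)) (x := x) (b := !b)
          (by rw [lf 4 (by simp), k4]; rfl) l2 (by rw [lf 5 (by simp), k5])).weaken le_rfl ?_
        rintro s4 ⟨m5, mf⟩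
        refine ⟨?_, ?_, ?_⟩
        · rw [mf 4 (by simp), lf 4 (by simp), k4]
        · rw [m5, Function.update_idem]
        · exact (hf2.trans lf (Z := [2, 4, 5, 6, 7, 8, 9, 10, 11, 12]) (by simp) (by simp)).trans
            mf (by simp) (by simp)
    · exact (Det.skip ⟨k4, k5, hf2⟩).weaken (by omega) fun _ h => h
  · rintro s3 ⟨l4, l5, lf⟩
    refine Det.assign ⟨?_, ?_, ?_, lf.update (by simp) _⟩
    · simp [Expr.eval, l4]
    · simpa using l5
    · split_ifs
      · exact ⟨_, rfl⟩
      · exact ⟨_, rfl⟩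

/-! ### Shuffling the variables -/

/-- Split off the entries of a list whose coins show heads. -/
noncomputable def splitPMF (x : Fin n) (p : List (Fin n) × List (Fin n)) :
    PMF (List (Fin n) × List (Fin n)) :=
  (PMF.uniformOfFintype Bool).map fun b => if b then (x :: p.1, p.2) else (p.1, x :: p.2)

/-- Toss a coin for each entry of a list, and move the entries with heads to the end. -/
noncomputable def roundPMF (l : List (Fin n)) : PMF (List (Fin n)) :=
  (PMF.foldl splitPMF l ([], [])).map fun p => p.2.reverse ++ p.1.reverse

/-- Shuffle the variables by `n` rounds. -/
noncomputable def shufflePMF (n : ℕ) : PMF (List (Fin n)) :=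
  PMF.foldl (fun _ : Unit => roundPMF) (List.replicate n ()) (List.finRange n)

/-- A list of variables. -/
def encodeOrder (l : List (Fin n)) : Val := .ofList (l.map fun x : Fin n => Val.ofNat x)

/-- The program for `roundPMF`. -/
def round : Prog :=
  block [.assign 6 .nil, .assign 7 .nil,
    .loop (.var 4) (block [.flip 2,
      .ite (.var 2) (.assign 6 (.cons (.hd (.var 4)) (.var 6)))
        (.assign 7 (.cons (.hd (.var 4)) (.var 7))),
      .assign 4 (.tl (.var 4))]),
    moveList 6 4, moveList 7 4]

/-- The two stacks hold their entries in reverse, and `moveList` reverses them again: a round is a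
stable partition. The permutation property is carried along since the length enters the time bounds.
-/
theorem spec_round {s : Store} {l : List (Fin n)} (h4 : s 4 = encodeOrder l)
    (hl : l.Perm (List.finRange n)) :
    Spec round s (20 * n + 20) (roundPMF l) fun l' s' =>
      s' 4 = encodeOrder l' ∧ l'.Perm (List.finRange n) ∧ Frame [2, 4, 6, 7] s s' := by
  have hln : l.length = n := by simpa using hl.length_eq
  refine Spec.map ?_
  refine Spec.weaken (Spec.assign_seq <| Spec.assign_seq <|
    Spec.seq_det (T' := 8 * n + 4) (Spec.loop (T := 6) splitPMF (fun l p s' =>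
      s' 4 = encodeOrder l ∧ s' 6 = encodeOrder p.1 ∧ s' 7 = encodeOrder p.2 ∧
      (p.1 ++ p.2 ++ l).Perm (List.finRange n) ∧ Frame [2, 4, 6, 7] s s') ?_ ?_ l ([], []) _
      ⟨?_, ?_, ?_, by simpa using hl, ?_⟩) ?_) (by rw [hln]; omega) fun _ _ h => h
  · rintro p s' ⟨h, -, -⟩
    simp [Expr.eval, h, encodeOrder]
  · rintro x l p s' ⟨g4, g6, g7, hp, hf⟩
    refine ⟨by simp [Expr.eval, g4, encodeOrder], ?_⟩
    refine Spec.map ?_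
    refine Spec.weaken (Spec.seq_det (T' := 4) (Spec.flip 2 s') ?_) (by omega) fun _ _ h => h
    rintro b _ rfl
    refine Det.seq (T := 2) (T' := 1) (R := fun s'' =>
      s'' 4 = encodeOrder (x :: l) ∧
      s'' 6 = encodeOrder (if b then (x :: p.1, p.2) else (p.1, x :: p.2)).1 ∧
      s'' 7 = encodeOrder (if b then (x :: p.1, p.2) else (p.1, x :: p.2)).2 ∧
      Frame [2, 4, 6, 7] s s'') ?_ ?_
    · refine Det.ite ?_
      simp only [Expr.eval, Function.update_self, Val.isCons_ofBool]
      cases b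
      · refine Det.assign ⟨?_, ?_, ?_, (hf.update (by simp) _).update (by simp) _⟩
        · simpa using g4
        · simpa using g6
        · simp [Expr.eval, g4, g7, encodeOrder]
      · refine Det.assign ⟨?_, ?_, ?_, (hf.update (by simp) _).update (by simp) _⟩
        · simpa using g4
        · simp [Expr.eval, g4, g6, encodeOrder]
        · simpa using g7
    · rintro s'' ⟨k4, k6, k7, kf⟩
      refine Det.assign ⟨?_, by simpa using k6, by simpa using k7, ?_, kf.update (by simp) _⟩
      · simp [Expr.eval, k4, encodeOrder]
      · refine List.Perm.trans ?_ hp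
        cases b
        · exact (List.append_assoc p.1 (x :: p.2) l ▸ List.append_assoc p.1 p.2 (x :: l) ▸
            List.Perm.append_left p.1 List.perm_middle.symm)
        · exact List.perm_middle.symm
  · simpa [Expr.eval] using h4
  · simp [Expr.eval, encodeOrder]
  · simp [Expr.eval, encodeOrder]
  · exact ((Frame.refl _ s).update (by simp) _).update (by simp) _
  · rintro p s' ⟨g4, g6, g7, hp, hf⟩
    have hlen := hp.length_eq
    simp at hlen
    refine Det.weaken (Det.seq (T := 4 * n + 1) (T' := 4 * n + 1)
      (Det.weaken (det_moveList (by simp) g6 g4) (by simp; omega) fun _ h => h) ?_)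
      (by omega) fun _ h => h
    rintro s'' ⟨k4, kf⟩
    refine Det.weaken (det_moveList (l := p.2.map fun x : Fin n => Val.ofNat x) (by simp)
      ((kf 7 (by simp)).trans g7) k4)
      (by simp; omega) ?_
    rintro t ⟨m4, mf⟩
    refine ⟨?_, ?_, (hf.trans kf (Z := [2, 4, 6, 7]) (by simp) (by simp)).trans mf (by simp)
      (by simp)⟩
    · rw [m4]
      simp [encodeOrder]
    · refine List.Perm.trans ?_ hp
      rw [List.append_nil]
      exact List.perm_append_comm.trans
        (List.Perm.append (List.reverse_perm _) (List.reverse_perm _))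

/-- The program for `shufflePMF`. -/
def shuffle : Prog :=
  block [.assign 2 (.hd (.var 0)), .assign 4 .nil,
    .loop (.var 2) (block [.assign 2 (.tl (.var 2)), .assign 4 (.cons (.var 2) (.var 4))]),
    .assign 3 (.hd (.var 0)),
    .loop (.var 3) (block [.assign 3 (.tl (.var 3)), round])]

/-- The counter runs down from `n` in unary, and each of its values is itself the code of the
variable to be pushed; the list is therefore built from its end. -/
theorem det_initOrder {s : Store} (h2 : s 2 = .ofNat n) (h4 : s 4 = .nil) :
    Det (.loop (.var 2) (block [.assign 2 (.tl (.var 2)), .assign 4 (.cons (.var 2) (.var 4))])) s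
      (4 * n + 1) fun s' => s' 4 = encodeOrder (List.finRange n) ∧ Frame [2, 4] s s' := by
  refine (Det.loop (T := 3) (fun (a : Unit) (_ : Unit) => a)
    (fun l _ s' => s' 2 = .ofNat l.length ∧
      s' 4 = .ofList ((List.range' l.length (n - l.length)).map Val.ofNat) ∧
      l.length ≤ n ∧ Frame [2, 4] s s')
    ?_ ?_ (List.replicate n ()) () s ⟨by simpa using h2, by simpa using h4, by simp,
      Frame.refl _ _⟩).weaken (by simp; omega) ?_
  · rintro a s' ⟨h, -, -⟩
    simp [Expr.eval, h, Val.ofNat]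
  · rintro x l a s' ⟨h1, h2, h3, h4⟩
    rw [List.length_cons] at h1 h2 h3
    rw [Val.ofNat_succ] at h1
    refine ⟨by simp [Expr.eval, h1], Det.assign_seq (Det.assign ⟨?_, ?_, by omega, ?_⟩)⟩
    · simp [Expr.eval, h1]
    · rw [show n - l.length = (n - (l.length + 1)) + 1 by omega, List.range'_succ]
      simp [Expr.eval, h1, h2]
    · exact (h4.update (by simp) _).update (by simp) _
  · rintro s' ⟨-, h2, -, h3⟩
    refine ⟨?_, h3⟩
    rw [h2, encodeOrder, List.length_nil, Nat.sub_zero, ← List.range_eq_range',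
      ← List.map_coe_finRange_eq_range, List.map_map]
    rfl

/-- A bound for the running time of `shuffle`. -/
def shuffleTime (n : ℕ) : ℕ := n * (20 * n + 23) + 4 * n + 20

theorem spec_shuffle {s : Store} (h0 : (s 0).hd = .ofNat n) :
    Spec shuffle s (shuffleTime n) (shufflePMF n) fun l s' =>
      s' 4 = encodeOrder l ∧ l.Perm (List.finRange n) ∧ Frame [2, 3, 4, 6, 7] s s' := by
  refine Spec.weaken (Spec.assign_seq <| Spec.assign_seq <| Det.seq_spec
    (T' := n * (20 * n + 23) + 3) (det_initOrder (n := n) ?_ ?_) ?_)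
    (by simp only [shuffleTime]; omega) fun _ _ h => h
  · simpa [Expr.eval] using h0
  · simp [Expr.eval]
  rintro s1 ⟨g4, gf⟩
  have hf : Frame [2, 3, 4, 6, 7] s s1 := Frame.trans (X := [2, 4])
    (((Frame.refl _ s).update (by simp) _).update (by simp) _) gf (by simp) (by simp)
  refine Spec.weaken (Spec.assign_seq <| Spec.loop (T := 20 * n + 22) (fun _ : Unit => roundPMF)
    (fun u l s' => s' 3 = .ofNat u.length ∧ s' 4 = encodeOrder l ∧ l.Perm (List.finRange n) ∧
      Frame [2, 3, 4, 6, 7] s s') ?_ ?_ (List.replicate n ()) (List.finRange n) _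
      ⟨?_, ?_, List.Perm.refl _, hf.update (by simp) _⟩) (by simp) ?_
  · rintro a s' ⟨h, -, -⟩
    simp [Expr.eval, h, Val.ofNat]
  · rintro x u l s' ⟨k3, k4, kl, kf⟩
    rw [List.length_cons, Val.ofNat_succ] at k3
    refine ⟨by simp [Expr.eval, k3], Spec.assign_seq ?_⟩
    refine (spec_round (l := l) (by simpa using k4) kl).weaken le_rfl ?_
    rintro l' s'' ⟨m4, ml, mf⟩
    refine ⟨?_, m4, ml, ?_⟩
    · rw [mf 3 (by simp)]
      simp [Expr.eval, k3]
    · exact (kf.update (by simp) _).trans mf (by simp) (by simp)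
  · simp [Expr.eval, hf 0 (by simp), h0]
  · simpa using g4
  · rintro l s' ⟨-, k4, kl, kf⟩
    exact ⟨k4, kl, kf⟩

end RandWhile

namespace RandWhile

variable {n : ℕ}

/-! ### Recording solutions -/

/-- The total assignment underlying a partial one. -/
def total (α : Fin n → Option Bool) (i : Fin n) : Bool := (α i).getD false

/-- The first solution that was found, together with the solution farthest from it. -/
def record (F : Std.Sat.CNF (Fin n)) (y : Fin n → Bool) :
    Option ((Fin n → Bool) × (Fin n → Bool)) → Option ((Fin n → Bool) × (Fin n → Bool))
  | none => if F.eval y then some (y, y) else none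
  | some z => if F.eval y ∧ hammingDist z.1 z.2 < hammingDist z.1 y then some (z.1, y) else some z

theorem falsifies_eq (F : Std.Sat.CNF (Fin n)) {α : Fin n → Option Bool} (h : ∀ i, α i ≠ none) :
    falsifies F α = !F.eval (total α) := by
  have h1 : ∀ l : Fin n × Bool, (α l.1 == some (!l.2)) = !(total α l.1 == l.2) := by
    rintro ⟨i, b⟩
    have := h i
    rcases hi : α i with _ | _ | _ <;> cases b <;> simp_all [total]
  rw [falsifies, Std.Sat.CNF.eval, ← Array.all_toList, List.not_all_eq_any_not]
  congr 1
  funext C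
  rw [Std.Sat.CNF.Clause.eval, List.not_any_eq_all_not]
  congr 1
  funext l
  exact h1 l

/-- The registers `13` to `16` hold the recorded solutions and their distance. -/
def Records : Option ((Fin n → Bool) × (Fin n → Bool)) → Store → Prop
  | none, s => s 15 = .nil ∧ s 16 = .nil
  | some z, s => s 13 = encodeAssignment z.1 ∧ s 14 = encodeAssignment z.2 ∧
      s 15 = .ofNat (hammingDist z.1 z.2) ∧ s 16 = .cons .nil .nil

theorem Records.of_frame {σ : Option ((Fin n → Bool) × (Fin n → Bool))} {s s' : Store}
    {X : List ℕ} (h : Records σ s) (hf : Frame X s s')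
    (hX : 13 ∉ X ∧ 14 ∉ X ∧ 15 ∉ X ∧ 16 ∉ X) : Records σ s' := by
  obtain ⟨h1, h2, h3, h4⟩ := hX
  cases σ with
  | none => simpa only [Records, hf 15 h3, hf 16 h4] using h
  | some z => simpa only [Records, hf 13 h1, hf 14 h2, hf 15 h3, hf 16 h4] using h

/-- Copy the total assignment of register `5` to register `2`. -/
def extract : Prog :=
  block [.assign 2 (.var 5), .assign 3 .nil,
    .loop (.var 2) (block [.assign 3 (.cons (.hd (.hd (.var 2))) (.var 3)),
      .assign 2 (.tl (.var 2))]),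
    moveList 3 2]

theorem hd_encodeEntry (o : Option Bool) : (encodeEntry o).hd = .ofBool (o.getD false) := by
  rcases o with _ | _ | _ <;> rfl

theorem det_extract {s : Store} {α : Fin n → Option Bool} (h5 : s 5 = encodePartial α) :
    Det extract s (8 * n + 10) fun s' =>
      s' 2 = encodeAssignment (total α) ∧ Frame [2, 3] s s' := by
  refine Det.weaken (Det.assign_seq <| Det.assign_seq <| Det.seq (T' := 4 * n + 1)
    (Det.loop (T := 3) (fun (a : List Val) v => Val.hd v :: a)
      (fun l a s' => s' 2 = .ofList l ∧ s' 3 = .ofList a ∧ Frame [2, 3] s s') ?_ ?_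
      (List.ofFn fun i => encodeEntry (α i)) [] _ ⟨?_, ?_, ?_⟩) ?_) (by simp; omega) fun _ h => h
  · rintro a s' ⟨h, -, -⟩
    simp [Expr.eval, h]
  · rintro x l a s' ⟨h1, h2, h3⟩
    refine ⟨by simp [Expr.eval, h1], Det.assign_seq (Det.assign ⟨?_, ?_, ?_⟩)⟩
    · simp [Expr.eval, h1]
    · simp [Expr.eval, h1, h2]
    · exact (h3.update (by simp) _).update (by simp) _
  · simpa [Expr.eval, encodePartial] using h5
  · simp [Expr.eval]
  · exact ((Frame.refl _ s).update (by simp) _).update (by simp) _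
  · rintro s' ⟨h2, h3, hf⟩
    have : ∀ (l acc : List Val), l.foldl (fun (a : List Val) v => Val.hd v :: a) acc =
        (l.map Val.hd).reverse ++ acc := by
      intro l
      induction l with
      | nil => simp
      | cons x l ih => intro acc; simp [ih]
    rw [this, List.append_nil] at h3
    refine (det_moveList (by simp) h3 h2).weaken (by simp) ?_
    rintro s'' ⟨k1, k2⟩
    refine ⟨?_, hf.trans k2 (by simp) (by simp)⟩
    rw [k1, List.reverse_reverse, List.append_nil, encodeAssignment, List.map_ofFn]
    congr 2
    funext i
    exact hd_encodeEntry (α i)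

/-- Store the Hamming distance of the assignments in registers `13` and `2` in register `10`. -/
def distance : Prog :=
  block [.assign 3 (.var 13), .assign 9 (.var 2), .assign 10 .nil,
    .loop (.var 3) (block [
      .ite (.hd (.var 3)) (.ite (.hd (.var 9)) skip (.assign 10 (.cons .nil (.var 10))))
        (.ite (.hd (.var 9)) (.assign 10 (.cons .nil (.var 10))) skip),
      .assign 3 (.tl (.var 3)), .assign 9 (.tl (.var 9))])]

theorem det_distance {s : Store} {z y : Fin n → Bool} (h13 : s 13 = encodeAssignment z)
    (h2 : s 2 = encodeAssignment y) :
    Det distance s (10 * n + 10) fun s' =>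
      s' 10 = .ofNat (hammingDist z y) ∧ Frame [3, 9, 10] s s' := by
  refine Det.weaken (Det.assign_seq <| Det.assign_seq <| Det.assign_seq <|
    Det.loop (T := 9) (fun (d : ℕ) (p : Bool × Bool) => if p.1 ≠ p.2 then d + 1 else d)
      (fun l d s' => s' 3 = .ofList (l.map fun p => .ofBool p.1) ∧
        s' 9 = .ofList (l.map fun p => .ofBool p.2) ∧ s' 10 = .ofNat d ∧ Frame [3, 9, 10] s s')
      ?_ ?_ (List.ofFn fun i => (z i, y i)) 0 _ ⟨?_, ?_, ?_, ?_⟩) (by simp; omega) ?_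
  · rintro a s' ⟨h, -, -⟩
    simp [Expr.eval, h]
  · rintro ⟨p, q⟩ l d s' ⟨g3, g9, g10, gf⟩
    refine ⟨by simp [Expr.eval, g3], ?_⟩
    have hD0 : p = q → (if p ≠ q then d + 1 else d) = d := fun h => by simp [h]
    have hD1 : p ≠ q → (if p ≠ q then d + 1 else d) = d + 1 := fun h => by simp [h]
    generalize (if p ≠ q then d + 1 else d) = D at hD0 hD1
    set R : Store → Prop := fun s'' =>
      s'' 3 = s' 3 ∧ s'' 9 = s' 9 ∧ s'' 10 = .ofNat D ∧ Frame [3, 9, 10] s s''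
    refine Det.weaken (Det.seq (T := 3) (T' := 3) (R := R) ?_ ?_) (by omega) fun _ h => h
    · have hskip : p = q → Det skip s' 1 R := fun h =>
        Det.skip ⟨rfl, rfl, by rw [hD0 h]; exact g10, gf⟩
      have hincr : p ≠ q → Det (.assign 10 (.cons .nil (.var 10))) s' 1 R := fun h =>
        Det.assign ⟨by simp, by simp, by simp [hD1 h, Expr.eval, g10, Val.ofNat_succ],
          gf.update (by simp) _⟩
      have e3 : ((Expr.hd (.var 3)).eval s').isCons = p := by simp [Expr.eval, g3]
      have e9 : ((Expr.hd (.var 9)).eval s').isCons = q := by simp [Expr.eval, g9]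
      refine Det.ite ?_
      rw [e3]
      split_ifs with hp
      · refine Det.ite ?_
        rw [e9]
        split_ifs with hq
        · exact hskip (by rw [hp, hq])
        · exact hincr (by rw [hp]; exact fun h => hq h.symm)
      · refine Det.ite ?_
        rw [e9]
        split_ifs with hq
        · exact hincr (by rw [hq]; exact hp)
        · exact hskip (by simp_all)
    · rintro s'' ⟨k3, k9, k10, kf⟩
      refine Det.assign_seq (Det.assign ⟨?_, ?_, ?_, (kf.update (by simp) _).update (by simp) _⟩)
      · simp [Expr.eval, k3, g3]
      · simp [Expr.eval, k9, g9]
      · simpa using k10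
  · simp [Expr.eval, h13, encodeAssignment, List.map_ofFn, Function.comp_def]
  · simp [Expr.eval, h2, encodeAssignment, List.map_ofFn, Function.comp_def]
  · simp [Expr.eval, Val.ofNat]
  · exact (((Frame.refl _ s).update (by simp) _).update (by simp) _).update (by simp) _
  · rintro s' ⟨-, -, h10, hf⟩
    refine ⟨?_, hf⟩
    rw [h10]
    congr 1
    have : ∀ (l : List (Bool × Bool)) (d : ℕ),
        l.foldl (fun (d : ℕ) (p : Bool × Bool) => if p.1 ≠ p.2 then d + 1 else d) d =
        d + (l.map fun p => if p.1 ≠ p.2 then 1 else 0).sum := by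
      intro l
      induction l with
      | nil => simp
      | cons x l ih =>
        intro d
        rw [List.foldl_cons, ih, List.map_cons, List.sum_cons]
        split_ifs <;> omega
    rw [this, zero_add, List.map_ofFn, List.sum_ofFn, hammingDist, Finset.card_filter]
    rfl

/-- Record the assignment in register `5`. -/
def update : Prog :=
  .seq extract <|
    .ite (.var 16)
      (.seq distance <| block [.assign 3 (.var 15), .assign 9 (.var 10),
        .loop (.var 3) (block [.assign 3 (.tl (.var 3)), .assign 9 (.tl (.var 9))]),
        .ite (.var 9) (block [.assign 14 (.var 2), .assign 15 (.var 10)]) skip])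
      (block [.assign 13 (.var 2), .assign 14 (.var 2), .assign 16 (.cons .nil .nil)])

/-- Truncated subtraction replaces the comparison of distances: `b - a` is not `nil` iff `a < b`. -/
theorem det_subtract {s : Store} {a b : ℕ} (h3 : s 3 = .ofNat a) (h9 : s 9 = .ofNat b) :
    Det (.loop (.var 3) (block [.assign 3 (.tl (.var 3)), .assign 9 (.tl (.var 9))])) s
      (4 * a + 1) fun s' => s' 9 = .ofNat (b - a) ∧ Frame [3, 9] s s' := by
  refine (Det.loop (T := 3) (fun (c : ℕ) (_ : Unit) => c - 1)
    (fun l c s' => s' 3 = .ofNat l.length ∧ s' 9 = .ofNat c ∧ Frame [3, 9] s s')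
    ?_ ?_ (List.replicate a ()) b s ⟨by simpa using h3, h9, Frame.refl _ _⟩).weaken
      (by simp; omega) ?_
  · rintro a s' ⟨h, -, -⟩
    simp [Expr.eval, h, Val.ofNat]
  · rintro x l c s' ⟨h1, h2, h3⟩
    rw [List.length_cons, Val.ofNat_succ] at h1
    refine ⟨by simp [Expr.eval, h1], Det.assign_seq (Det.assign ⟨?_, ?_, ?_⟩)⟩
    · simp [Expr.eval, h1]
    · cases c
      · simp [Expr.eval, h2, Val.ofNat]
      · simp [Expr.eval, h2, Val.ofNat_succ]
    · exact (h3.update (by simp) _).update (by simp) _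
  · rintro s' ⟨-, h2, h3⟩
    refine ⟨?_, h3⟩
    rw [h2]
    congr 1
    clear * -
    induction a generalizing b with
    | zero => rfl
    | succ a ih => rw [List.replicate_succ, List.foldl_cons, ih]; omega

theorem isCons_ofNat (n : ℕ) : (Val.ofNat n).isCons = decide (0 < n) := by cases n <;> rfl

theorem det_update {s : Store} {F : Std.Sat.CNF (Fin n)} {α : Fin n → Option Bool}
    {σ : Option ((Fin n → Bool) × (Fin n → Bool))} (h5 : s 5 = encodePartial α)
    (hσ : Records σ s) (hF : F.eval (total α) = true) :
    Det update s (30 * n + 50) fun s' => Records (record F (total α) σ) s' ∧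
      Frame [2, 3, 9, 10, 13, 14, 15, 16] s s' := by
  refine Det.weaken (Det.seq (T' := 14 * n + 30) (det_extract h5) ?_) (by omega) fun _ h => h
  rintro s1 ⟨g2, gf⟩
  have hσ1 := hσ.of_frame gf (by simp)
  have hf1 : Frame [2, 3, 9, 10, 13, 14, 15, 16] s s1 :=
    (Frame.refl [] s).trans gf (by simp) (by simp)
  refine Det.weaken (Det.ite (T := 14 * n + 29) ?_) (by omega) fun _ h => h
  cases σ with
  | none =>
    obtain ⟨h15, h16⟩ := hσ1
    simp only [Expr.eval, h16, Val.isCons_nil, Bool.false_eq_true, if_false]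
    refine Det.weaken (Det.assign_seq <| Det.assign_seq <| Det.assign ⟨?_,
      ((hf1.update (by simp) _).update (by simp) _).update (by simp) _⟩) (by omega) fun _ h => h
    rw [record, if_pos hF]
    -- The pair recorded first consists of two equal solutions; its distance is zero, which is the
    -- `nil` already in register 15.
    simp [Records, Expr.eval, g2, h15, Val.ofNat]
  | some z =>
    obtain ⟨h13, h14, h15, h16⟩ := hσ1
    simp only [Expr.eval, h16, Val.isCons_cons, if_true]
    refine Det.weaken (Det.seq (T' := 4 * n + 12) (det_distance h13 g2) ?_) (by omega)
      fun _ h => h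
    rintro s2 ⟨k10, kf⟩
    have hf2 : Frame [2, 3, 9, 10, 13, 14, 15, 16] s s2 := hf1.trans kf (by simp) (by simp)
    have hd : hammingDist z.1 z.2 ≤ n := by simpa using hammingDist_le_card_fintype (x := z.1)
    refine Det.weaken (Det.assign_seq <| Det.assign_seq <| Det.seq (T' := 6)
      (det_subtract (a := hammingDist z.1 z.2) (b := hammingDist z.1 (total α)) ?_ ?_) ?_)
      (by omega) fun _ h => h
    · simpa [Expr.eval, kf 15 (by simp)] using h15
    · simpa [Expr.eval] using k10
    rintro s3 ⟨l9, lf⟩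
    have hf3 : Frame [2, 3, 9, 10, 13, 14, 15, 16] s s3 := Frame.trans
      (X := [2, 3, 9, 10, 13, 14, 15, 16])
      ((hf2.update (by simp) _).update (by simp) _) lf (by simp) (by simp)
    have e2 : s3 2 = encodeAssignment (total α) := by
      rw [lf 2 (by simp)]
      simpa [kf 2 (by simp)] using g2
    have e10 : s3 10 = .ofNat (hammingDist z.1 (total α)) := by
      rw [lf 10 (by simp)]
      simpa using k10
    have e13 : s3 13 = encodeAssignment z.1 := by
      rw [lf 13 (by simp)]
      simpa [kf 13 (by simp)] using h13
    have e14 : s3 14 = encodeAssignment z.2 := by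
      rw [lf 14 (by simp)]
      simpa [kf 14 (by simp)] using h14
    have e15 : s3 15 = .ofNat (hammingDist z.1 z.2) := by
      rw [lf 15 (by simp)]
      simpa [kf 15 (by simp)] using h15
    have e16 : s3 16 = .cons .nil .nil := by
      rw [lf 16 (by simp)]
      simpa [kf 16 (by simp)] using h16
    refine Det.weaken (Det.ite (T := 3) ?_) (by omega) fun _ h => h
    simp only [Expr.eval, l9, isCons_ofNat, decide_eq_true_eq, tsub_pos_iff_lt]
    simp only [record, hF, true_and]
    split_ifs with h
    · refine Det.assign_seq (Det.assign ⟨?_, (hf3.update (by simp) _).update (by simp) _⟩)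
      simp [Records, Expr.eval, e2, e10, e13, e16]
    · exact (Det.skip ⟨⟨e13, e14, e15, e16⟩, hf3⟩).weaken (by omega) fun _ h => h

/-! ### One trial -/

/-- The random assignment of a trial. -/
noncomputable def ppzPMF (F : Std.Sat.CNF (Fin n)) : PMF (Fin n → Option Bool) :=
  (shufflePMF n).bind fun l => PMF.foldl (assignPMF F) l fun _ => none

/-- One trial. -/
noncomputable def trialPMF (F : Std.Sat.CNF (Fin n))
    (σ : Option ((Fin n → Bool) × (Fin n → Bool))) :
    PMF (Option ((Fin n → Bool) × (Fin n → Bool))) :=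
  (ppzPMF F).map fun α => record F (total α) σ

/-- The program for `trialPMF`. -/
def trial : Prog :=
  block [shuffle, .assign 5 (.hd (.var 0)), .loop (.var 4) assignVar, check,
    .ite (.var 6) skip update]

/-- A bound for the running time of `trial`. -/
def trialTime (k n m : ℕ) : ℕ :=
  shuffleTime n + n * (assignTime k n m + 1) + checkTime k n m + 30 * n + 70

/-- Both are lists of `n` copies of `nil`, so the number of variables in the input also serves as
the initial empty assignment. -/
theorem ofNat_eq_encodePartial (n : ℕ) : Val.ofNat n = encodePartial fun _ : Fin n => none := by
  rw [Val.ofNat, encodePartial, List.ofFn_const]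
  rfl

theorem spec_trial {s : Store} {k : ℕ} {F : Std.Sat.CNF (Fin n)}
    {σ : Option ((Fin n → Bool) × (Fin n → Bool))} (hF : KSat.IsKCNF k F)
    (h0 : s 0 = encodeFormula F) (hσ : Records σ s) :
    Spec trial s (trialTime k n F.clauses.size) (trialPMF F σ) fun σ' s' =>
      Records σ' s' ∧ s' 0 = s 0 ∧ s' 1 = s 1 := by
  set c := checkTime k n F.clauses.size with hc
  set a := assignTime k n F.clauses.size with ha
  have hhd : (s 0).hd = .ofNat n := by rw [h0]; rfl
  refine Spec.map ?_
  refine Spec.weaken (Spec.seq (T' := n * (a + 1) + c + 30 * n + 65)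
    (spec_shuffle hhd) fun l s1 hs1 => ?_) (by simp only [trialTime, ← hc, ← ha]; omega)
    fun _ _ h => h
  obtain ⟨g4, gl, gf⟩ := hs1
  have hln : l.length = n := by simpa using gl.length_eq
  refine Spec.weaken (Spec.assign_seq <| Spec.seq_det (T' := c + 30 * n + 60)
    (Spec.loop (T := a) (assignPMF F) (fun l α s' => s' 4 = encodeOrder l ∧
      s' 5 = encodePartial α ∧ (∀ i ∉ l, α i ≠ none) ∧
      Frame [2, 3, 4, 5, 6, 7, 8, 9, 10, 11, 12] s s') ?_ ?_ l (fun _ => none) _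
      ⟨?_, ?_, ?_, ?_⟩) ?_) (by rw [hln]; omega) fun _ _ h => h
  · rintro α s' ⟨h, -, -⟩
    simp [Expr.eval, h, encodeOrder]
  · rintro x l α s' ⟨k4, k5, kα, kf⟩
    refine ⟨by simp [Expr.eval, k4, encodeOrder], ?_⟩
    refine (spec_assignVar (v := encodeOrder l) hF ((kf 0 (by simp)).trans h0) k4 k5).weaken
      le_rfl ?_
    rintro α' s'' ⟨l4, l5, ⟨b, hb⟩, lf⟩
    refine ⟨l4, l5, fun i hi => ?_, kf.trans lf (by simp) (by simp)⟩
    rw [hb]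
    by_cases hix : i = x
    · simp [hix]
    · rw [Function.update_of_ne hix]
      exact kα i (by simp [hix, hi])
  · simpa using g4
  · simp [Expr.eval, gf 0 (by simp), hhd, ofNat_eq_encodePartial]
  · exact fun i hi => absurd (gl.mem_iff.2 (List.mem_finRange i)) hi
  · exact Frame.update ((Frame.refl [] s).trans gf (by simp) (by simp)) (by simp) _
  · rintro α s' ⟨-, k5, kα, kf⟩
    refine Det.weaken (Det.seq (T' := 30 * n + 51)
      (det_check hF ((kf 0 (by simp)).trans h0) k5) ?_) (by omega) fun _ h => h
    rintro s2 ⟨l6, lf⟩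
    have hf2 : Frame [2, 3, 4, 5, 6, 7, 8, 9, 10, 11, 12] s s2 :=
      kf.trans lf (by simp) (by simp)
    have hσ2 := hσ.of_frame hf2 (by simp)
    refine Det.ite ?_
    simp only [Expr.eval, l6, Val.isCons_ofBool]
    -- By the invariant every variable outside the remaining list has a value; the list is now
    -- empty, so `check` decides satisfaction.
    rw [falsifies_eq F fun i => kα i (by simp)]
    split_ifs with h
    · refine (Det.skip ?_).weaken (by omega) fun _ h => h
      have : record F (total α) σ = σ := by
        rw [Bool.not_eq_true', ← Bool.not_eq_true] at h
        cases σ <;> simp [record, h]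
      exact ⟨by rwa [this], hf2 0 (by simp), hf2 1 (by simp)⟩
    · refine (det_update ((lf 5 (by simp)).trans k5) hσ2 (by simpa using h)).weaken le_rfl ?_
      rintro s3 ⟨m1, m2⟩
      exact ⟨m1, (m2 0 (by simp)).trans (hf2 0 (by simp)),
        (m2 1 (by simp)).trans (hf2 1 (by simp))⟩

/-! ### The number of trials -/

/-- Double the number in register `1`. -/
def double : Prog :=
  block [.assign 2 (.var 1),
    .loop (.var 2) (block [.assign 1 (.cons .nil (.var 1)), .assign 2 (.tl (.var 2))])]

theorem det_double {s : Store} {N : ℕ} (h1 : s 1 = .ofNat N) :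
    Det double s (4 * N + 3) fun s' => s' 1 = .ofNat (2 * N) ∧ Frame [1, 2] s s' := by
  refine Det.weaken (Det.assign_seq <| Det.loop (T := 3) (fun (c : ℕ) (_ : Unit) => c + 1)
    (fun l c s' => s' 2 = .ofNat l.length ∧ s' 1 = .ofNat c ∧ Frame [1, 2] s s')
    ?_ ?_ (List.replicate N ()) N _ ⟨?_, by simpa using h1,
      (Frame.refl _ s).update (by simp) _⟩) (by simp; omega) ?_
  · rintro a s' ⟨h, -, -⟩
    simp [Expr.eval, h, Val.ofNat]
  · rintro x l c s' ⟨h1, h2, h3⟩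
    rw [List.length_cons, Val.ofNat_succ] at h1
    refine ⟨by simp [Expr.eval, h1], Det.assign_seq (Det.assign ⟨?_, ?_, ?_⟩)⟩
    · simp [Expr.eval, h1]
    · simp [Expr.eval, h2, Val.ofNat_succ]
    · exact (h3.update (by simp) _).update (by simp) _
  · simpa [Expr.eval] using h1
  · rintro s' ⟨-, h2, h3⟩
    refine ⟨?_, h3⟩
    rw [h2]
    congr 1
    have : ∀ N c : ℕ, (List.replicate N ()).foldl (fun (c : ℕ) (_ : Unit) => c + 1) c = c + N := by
      intro N
      induction N with
      | zero => simp
      | succ N ih => intro c; rw [List.replicate_succ, List.foldl_cons, ih]; omega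
    rw [this]
    omega

/-- An expression for a number. -/
def numeral : ℕ → Expr
  | 0 => .nil
  | c + 1 => .cons .nil (numeral c)

theorem eval_numeral (s : Store) (c : ℕ) : (numeral c).eval s = .ofNat c := by
  induction c with
  | zero => rfl
  | succ c ih => rw [numeral, Expr.eval, ih]; rfl

/-- The number of trials. -/
def trials (k n : ℕ) : ℕ := (n + 1) * 2 ^ (n - n / k)

/-- Compute the number of trials in register `1`. -/
def counter (k : ℕ) : Prog :=
  block [.assign 3 (.hd (.var 0)), .assign 4 (numeral (k - 1)),
    .assign 1 (.cons .nil (.hd (.var 0))),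
    .loop (.var 3) (block [.assign 3 (.tl (.var 3)),
      .ite (.var 4) (block [.assign 4 (.tl (.var 4)), double]) (.assign 4 (numeral (k - 1)))])]

/-- A bound for the running time of `counter`. -/
def counterTime (k n : ℕ) : ℕ := n * (4 * trials k n + 20) + 20

/-- This makes `j - j / k` monotone in `j`, so that every intermediate value of the counter is
bounded by the final one. -/
theorem div_le_div_add {k j d : ℕ} (hk : 1 ≤ k) : (j + d) / k ≤ j / k + d := by
  rw [Nat.div_le_iff_le_mul_add_pred (by omega)]
  have h1 := Nat.div_add_mod j k
  have h2 := Nat.mod_lt j (show 0 < k by omega)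
  have h3 : d ≤ k * d := Nat.le_mul_of_pos_left d (by omega)
  rw [mul_add]
  omega

/-- Register 4 counts down cyclically from `k - 1`, and the round in which it is empty skips the
doubling. After `j` rounds there have been `j - j / k` doublings, without any division. -/
theorem det_counter {s : Store} {k : ℕ} (hk : 1 ≤ k) (h0 : (s 0).hd = .ofNat n) :
    Det (counter k) s (counterTime k n) fun s' =>
      s' 1 = .ofNat (trials k n) ∧ Frame [1, 2, 3, 4] s s' := by
  refine Det.weaken (Det.assign_seq <| Det.assign_seq <| Det.assign_seq <|
    Det.loop (T := 4 * trials k n + 15) (fun (c : Unit) (_ : Unit) => c)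
    (fun l _ s' => s' 3 = .ofNat l.length ∧ l.length ≤ n ∧
      s' 4 = .ofNat (k - 1 - (n - l.length) % k) ∧
      s' 1 = .ofNat ((n + 1) * 2 ^ ((n - l.length) - (n - l.length) / k)) ∧
      Frame [1, 2, 3, 4] s s')
    ?_ ?_ (List.replicate n ()) () _ ⟨?_, by simp, ?_, ?_, ?_⟩) ?_ ?_
  · rintro a s' ⟨h, -, -⟩
    simp [Expr.eval, h, Val.ofNat]
  · rintro x l c s' ⟨h3, hl, h4, h1, hf⟩
    rw [List.length_cons] at h3 hl h4 h1
    rw [Val.ofNat_succ] at h3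
    refine ⟨by simp [Expr.eval, h3], ?_⟩
    obtain ⟨j, hj⟩ : ∃ j, j = n - (l.length + 1) := ⟨_, rfl⟩
    have hj' : n - l.length = j + 1 := by omega
    rw [← hj] at h4 h1
    rw [hj']
    have hmod := Nat.mod_lt j (show 0 < k by omega)
    have hdiv : j / k ≤ j := Nat.div_le_self j k
    refine Det.weaken (Det.assign_seq <| Det.ite (T := 4 * trials k n + 6) ?_) (by omega)
      fun _ h => h
    have e4 : ((Expr.var 4).eval (Function.update s' 3 ((Expr.tl (.var 3)).eval s'))) =
      .ofNat (k - 1 - j % k) := by simp [Expr.eval, h4]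
    rw [e4, isCons_ofNat]
    simp only [decide_eq_true_eq]
    split_ifs with hc
    · have hm : (j + 1) % k = j % k + 1 := by
        rw [Nat.add_mod, Nat.mod_eq_of_lt (a := 1) (by omega), Nat.mod_eq_of_lt (by omega)]
      have hq : (j + 1) / k = j / k := by
        have h5 := Nat.div_add_mod j k
        have h6 := Nat.div_add_mod (j + 1) k
        rw [hm] at h6
        exact Nat.eq_of_mul_eq_mul_left (show 0 < k by omega) (by omega)
      have hbound : (n + 1) * 2 ^ (j - j / k) ≤ trials k n := by
        refine Nat.mul_le_mul_left _ (Nat.pow_le_pow_right (by omega) ?_)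
        have := div_le_div_add (j := j) (d := n - j) hk
        rw [show j + (n - j) = n by omega] at this
        have : n / k ≤ n := Nat.div_le_self n k
        omega
      refine Det.weaken (Det.assign_seq <| det_double (N := (n + 1) * 2 ^ (j - j / k)) ?_)
        (by omega) ?_
      · simpa using h1
      rintro s'' ⟨k1, kf⟩
      refine ⟨?_, by omega, ?_, ?_, ?_⟩
      · rw [kf 3 (by simp)]
        simp [Expr.eval, h3]
      · rw [kf 4 (by simp), hm]
        obtain ⟨d, hd⟩ : ∃ d, k - 1 - j % k = d + 1 := ⟨k - 1 - j % k - 1, by omega⟩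
        have : k - 1 - (j % k + 1) = d := by omega
        simp [Expr.eval, h4, hd, this, Val.ofNat_succ]
      · rw [k1, hq]
        congr 1
        rw [show j + 1 - j / k = (j - j / k) + 1 by omega, pow_succ]
        ring
      · exact Frame.trans (X := [1, 2, 3, 4]) ((hf.update (by simp) _).update (by simp) _) kf
          (by simp) (by simp)
    · have hm : j % k + 1 = k := by omega
      have h5 := Nat.div_add_mod j k
      have h6 : j + 1 = k * (j / k + 1) := by rw [mul_add, mul_one]; omega
      refine (Det.assign ⟨?_, by omega, ?_, ?_, ?_⟩).weaken (by omega) fun _ h => h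
      · simp [Expr.eval, h3]
      · rw [Function.update_self, eval_numeral, h6, Nat.mul_mod_right, Nat.sub_zero]
      · have hq : (j + 1) / k = j / k + 1 := by
          rw [h6]
          exact Nat.mul_div_cancel_left _ (by omega)
        rw [hq, show j + 1 - (j / k + 1) = j - j / k by omega]
        simpa using h1
      · exact (hf.update (by simp) _).update (by simp) _
  · simp [Expr.eval, h0]
  · simp [eval_numeral]
  · simp [Expr.eval, h0, Val.ofNat_succ]
  · exact (((Frame.refl _ s).update (by simp) _).update (by simp) _).update (by simp) _
  · simp only [counterTime, List.length_replicate]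
    have : n * (4 * trials k n + 15 + 1) ≤ n * (4 * trials k n + 20) :=
      Nat.mul_le_mul_left _ (by omega)
    omega
  · rintro s' ⟨-, -, -, h1, hf⟩
    exact ⟨by simpa [trials] using h1, hf⟩

/-! ### The algorithm -/

/-- The algorithm. -/
def main (k : ℕ) : Prog :=
  block [counter k, .loop (.var 1) (block [.assign 1 (.tl (.var 1)), trial]),
    .assign 0 (.cons (.var 13) (.var 14))]

/-- A bound for the running time of the algorithm. -/
def mainTime (k n m : ℕ) : ℕ :=
  counterTime k n + trials k n * (trialTime k n m + 3) + 10

/-- The random outcome of all trials. -/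
noncomputable def mainPMF (k : ℕ) (F : Std.Sat.CNF (Fin n)) :
    PMF (Option ((Fin n → Bool) × (Fin n → Bool))) :=
  PMF.foldl (fun _ : Unit => trialPMF F) (List.replicate (trials k n) ()) none

theorem spec_main {k : ℕ} (hk : 1 ≤ k) {F : Std.Sat.CNF (Fin n)} (hF : KSat.IsKCNF k F)
    {s : Store} (h0 : s 0 = encodeFormula F) (hs : ∀ i ≠ 0, s i = .nil) :
    Spec (main k) s (mainTime k n F.clauses.size) (mainPMF k F)
      fun σ s' => ∀ z, σ = some z → s' 0 = encodePair z.1 z.2 := by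
  refine Spec.weaken (Det.seq_spec
    (T' := trials k n * (trialTime k n F.clauses.size + 3) + 3)
    (det_counter (n := n) hk (by rw [h0]; rfl)) ?_) (by simp only [mainTime]; omega)
    fun _ _ h => h
  rintro s1 ⟨g1, gf⟩
  refine Spec.weaken (Spec.seq_det (T' := 1)
    (Spec.loop (T := trialTime k n F.clauses.size + 2) (fun _ : Unit => trialPMF F)
      (fun u σ s' => s' 1 = .ofNat u.length ∧ s' 0 = encodeFormula F ∧ Records σ s') ?_ ?_
      (List.replicate (trials k n) ()) none s1 ⟨?_, ?_, ?_, ?_⟩) ?_) (by simp)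
      fun _ _ h => h
  · rintro σ s' ⟨h, -⟩
    simp [Expr.eval, h, Val.ofNat]
  · rintro x u σ s' ⟨k1, k0, kσ⟩
    rw [List.length_cons, Val.ofNat_succ] at k1
    refine ⟨by simp [Expr.eval, k1], Spec.assign_seq ?_⟩
    refine (spec_trial hF (by simpa using k0)
      (kσ.of_frame (X := [1]) ((Frame.refl _ _).update (by simp) _) (by simp))).weaken le_rfl ?_
    rintro σ' s'' ⟨l1, l2, l3⟩
    refine ⟨?_, ?_, l1⟩
    · rw [l3]
      simp [Expr.eval, k1]
    · rw [l2]
      simpa using k0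
  · simpa using g1
  · rw [gf 0 (by simp), h0]
  · rw [gf 15 (by simp), hs 15 (by simp)]
  · rw [gf 16 (by simp), hs 16 (by simp)]
  · rintro σ s' ⟨-, -, hσ⟩
    refine Det.assign ?_
    rintro z rfl
    simp [Expr.eval, hσ.1, hσ.2.1, encodePair]

/-- Halting and success, in terms of the random outcome of all trials. -/
theorem main_correct {k : ℕ} (hk : 1 ≤ k) {F : Std.Sat.CNF (Fin n)} (hF : KSat.IsKCNF k F) :
    (main k).HaltsWithin (encodeFormula F) (mainTime k n F.clauses.size) ∧
    ∀ S : Set Val, ((mainPMF k F).expect fun σ =>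
        open Classical in if ∃ z, σ = some z ∧ encodePair z.1 z.2 ∈ S then 1 else 0) ≤
      (main k).outputProb (encodeFormula F) (mainTime k n F.clauses.size) S := by
  classical
  have hspec := spec_main hk hF (s := ((main k).init (encodeFormula F)).store)
    (by simp [Prog.init]) (fun i hi => by simp [Prog.init, hi])
  constructor
  -- With every output accepted, the specification says that the program halts in time with
  -- probability 1, and then every configuration in the support is final.
  · have h := hspec Set.univ [] 0 (fun _ => 1) fun σ s' _ => by
      rw [haltProb_zero, if_pos (by simp)]
    rw [PMF.expect_const, zero_add] at h
    have h1 : haltProb Set.univ (mainTime k n F.clauses.size)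
        ((main k).init (encodeFormula F)) = 1 := by
      refine le_antisymm ?_ h
      rw [haltProb, ← (run (mainTime k n F.clauses.size)
        ((main k).init (encodeFormula F))).tsum_coe, PMF.toOuterMeasure_apply]
      exact ENNReal.tsum_le_tsum fun c => Set.indicator_le_self' (fun _ _ => zero_le) c
    rw [haltProb] at h1
    intro c hc
    rw [PMF.toOuterMeasure_apply_eq_one_iff] at h1
    exact (h1 hc).1
  · intro S
    have h := hspec S [] 0 (fun σ => if ∃ z, σ = some z ∧ encodePair z.1 z.2 ∈ S then 1 else 0)
      fun σ s' hs' => by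
        split_ifs with hz
        · obtain ⟨z, rfl, hz⟩ := hz
          rw [haltProb_zero, if_pos ⟨rfl, by simpa only [hs' z rfl] using hz⟩]
        · exact zero_le
    rwa [zero_add] at h

end RandWhile

namespace KSat

variable {n : ℕ}

/-! ### Isolated directions -/

/-- Change one value of an assignment. -/
def flip (z : Fin n → Bool) (i : Fin n) : Fin n → Bool := Function.update z i (!z i)

/-- The number of the directions in `U` along which `z` is isolated in `S`. -/
def isolation (S : Finset (Fin n → Bool)) (U : Finset (Fin n)) (z : Fin n → Bool) : ℕ :=
  (U.filter fun i => flip z i ∉ S).card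

/-- Disagreements are counted inside and outside `V` separately. It is used for a single coordinate,
for all coordinates, and for the coordinates still free in the induction. -/
theorem card_agree_add_hammingDist (u y : Fin n → Bool) (V : Finset (Fin n)) :
    (V.filter fun j => y j = u j).card + hammingDist u y =
      V.card + (Vᶜ.filter fun j => u j ≠ y j).card := by
  have h1 : hammingDist u y =
      (V.filter fun j => u j ≠ y j).card + (Vᶜ.filter fun j => u j ≠ y j).card := by
    rw [hammingDist, ← Finset.card_union_of_disjoint, ← Finset.filter_union,
      Finset.union_compl]
    exact Finset.disjoint_filter_filter disjoint_compl_right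
  have h2 := Finset.card_filter_add_card_filter_not (s := V) fun j => y j = u j
  have h3 : (V.filter fun j => ¬ y j = u j) = V.filter fun j => u j ≠ y j :=
    Finset.filter_congr fun j _ => by rw [ne_comm, Ne]
  rw [h3] at h2
  omega

theorem hammingDist_flip (u z : Fin n → Bool) (i : Fin n) :
    (z i = u i → hammingDist u (flip z i) = hammingDist u z + 1) ∧
    (z i ≠ u i → hammingDist u (flip z i) + 1 = hammingDist u z) := by
  have h1 := card_agree_add_hammingDist u z {i}
  have h2 := card_agree_add_hammingDist u (flip z i) {i}
  have h3 : (({i}ᶜ : Finset (Fin n)).filter fun j => u j ≠ flip z i j) =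
      ({i}ᶜ : Finset (Fin n)).filter fun j => u j ≠ z j :=
    Finset.filter_congr fun j hj => by
      rw [flip, Function.update_of_ne (by simpa using hj)]
  rw [h3] at h2
  have h4 : flip z i i = !z i := by simp [flip]
  constructor
  · intro h
    have h5 : flip z i i ≠ u i := by rw [h4, ← h]; simp
    rw [Finset.filter_singleton, if_pos h] at h1
    rw [Finset.filter_singleton, if_neg h5] at h2
    simp at h1 h2
    omega
  · intro h
    have h5 : flip z i i = u i := by
      rw [h4]
      revert h
      cases z i <;> cases u i <;> simp
    rw [Finset.filter_singleton, if_neg h] at h1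
    rw [Finset.filter_singleton, if_pos h5] at h2
    simp at h1 h2
    omega

/-- The arithmetic of the induction step: splitting off a coordinate divides the first bound by `c`
in both halves, leaves the second one unchanged in the half of the farthest point, and at worst
halves it in the other. -/
theorem min_add_min {A B B' c : ℝ} (hA : 0 < A) (hB : 0 < B) (hB' : B / 2 ≤ B') (hc : c ≤ 2) :
    min (c * A) B ≤ min A B + min A B' := by
  have h1 : min (2 * A) B ≤ min A B + min A (B / 2) := by
    rcases le_total B A with h | h
    · rw [min_eq_right h, min_eq_right (show B / 2 ≤ A by linarith)]
      exact (min_le_right _ _).trans (by linarith)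
    · rw [min_eq_left h]
      rcases le_total A (B / 2) with h' | h'
      · rw [min_eq_left h']
        exact (min_le_left _ _).trans (by linarith)
      · rw [min_eq_right h']
        exact (min_le_right _ _).trans (by linarith)
  have h2 : min (c * A) B ≤ min (2 * A) B := min_le_min_right _ (by nlinarith)
  have h3 : min A (B / 2) ≤ min A B' := min_le_min_left _ hB'
  linarith

/-- A weighted count of the points of `S` whose distance from `u` is not much smaller than the
largest one. -/
theorem le_sum_isolation {c : ℝ} (hc0 : 0 ≤ c) (hc1 : c ≤ 1) (u : Fin n → Bool) (m : ℕ) :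
    ∀ (U : Finset (Fin n)) (S : Finset (Fin n → Bool)) (z : Fin n → Bool) (h : ℕ),
      U.card = m → z ∈ S → (∀ y ∈ S, hammingDist u y ≤ hammingDist u z) →
      (∀ y ∈ S, ∀ i, i ∉ U → y i = z i) → h ≤ hammingDist u z →
      min ((2 : ℝ) ^ (c * m)) ((2 : ℝ) ^ (c * ((U.filter fun i => z i = u i).card : ℝ) +
        ((hammingDist u z : ℝ) - h))) ≤
      ∑ y ∈ S.filter (fun y => h ≤ hammingDist u y), (2 : ℝ) ^ (c * (isolation S U y : ℝ)) := by
  induction m with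
  | zero =>
    intro U S z h hU hz _ _ hh
    refine (min_le_left _ _).trans ?_
    refine le_trans ?_ (Finset.single_le_sum (f := fun y => (2 : ℝ) ^ (c * (isolation S U y : ℝ)))
      (fun y _ => by positivity) (Finset.mem_filter.2 ⟨hz, hh⟩))
    exact Real.rpow_le_rpow_of_exponent_le (by norm_num) (by
      rw [Nat.cast_zero, mul_zero]; positivity)
  | succ m ih =>
    intro U S z h hU hz hmax hoff hh
    have hterm : (2 : ℝ) ^ (c * (isolation S U z : ℝ)) ≤
        ∑ y ∈ S.filter (fun y => h ≤ hammingDist u y), (2 : ℝ) ^ (c * (isolation S U y : ℝ)) :=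
      Finset.single_le_sum (f := fun y => (2 : ℝ) ^ (c * (isolation S U y : ℝ)))
        (fun y _ => by positivity) (Finset.mem_filter.2 ⟨hz, hh⟩)
    have hup : ∀ i, z i = u i → flip z i ∉ S := fun i hi hS => by
      have := hmax _ hS
      rw [(hammingDist_flip u z i).1 hi] at this
      omega
    -- If `z` is isolated in all free directions, its own term already reaches the first entry of
    -- the minimum.
    by_cases hall : ∀ i ∈ U, flip z i ∉ S
    · refine (min_le_left _ _).trans (le_trans ?_ hterm)
      rw [isolation, Finset.filter_true_of_mem hall, hU]
    -- If no distance can be given up, the term of `z` still suffices: flipping a coordinate where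
    -- `z` agrees with `u` would increase the maximal distance, so all these directions are
    -- isolated.
    rcases hh.eq_or_lt with heq | hlt
    · refine (min_le_right _ _).trans (le_trans ?_ hterm)
      rw [heq, sub_self, add_zero]
      refine Real.rpow_le_rpow_of_exponent_le (by norm_num) (mul_le_mul_of_nonneg_left ?_ hc0)
      exact_mod_cast Finset.card_le_card (Finset.monotone_filter_right _ fun i _ hi => hup i hi)
    push Not at hall
    -- Otherwise `S` is split along a direction `i` in which `z` is not isolated; there `z`
    -- disagrees with `u`.
    obtain ⟨i, hiU, hiS⟩ := hall
    have hiu : z i ≠ u i := fun h => hup i h hiS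
    set V := U.erase i with hV
    have hVm : V.card = m := by rw [hV, Finset.card_erase_of_mem hiU, hU]; rfl
    set S₁ := S.filter fun y => y i = z i with hS₁
    set S₀ := S.filter fun y => ¬ y i = z i with hS₀
    have hflip : ∀ y : Fin n → Bool, ∀ j ∈ V, flip y j i = y i := fun y j hj => by
      rw [flip, Function.update_of_ne (Finset.ne_of_mem_erase hj).symm]
    -- A flip in a direction other than `i` stays in the same half, so a direction isolated in the
    -- half is isolated in `S`.
    have hiso : ∀ (p : Bool → Prop) [DecidablePred p] (y : Fin n → Bool), p (y i) →
        isolation (S.filter fun y => p (y i)) V y ≤ isolation S U y := by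
      intro p _ y hy
      refine Finset.card_le_card fun j hj => ?_
      rw [Finset.mem_filter] at hj ⊢
      refine ⟨Finset.mem_of_mem_erase hj.1, fun hjS => hj.2 ?_⟩
      rw [Finset.mem_filter, hflip y j hj.1]
      exact ⟨hjS, hy⟩
    have hsum : ∀ (p : Bool → Prop) [DecidablePred p],
        ∑ y ∈ (S.filter fun y => p (y i)).filter (fun y => h ≤ hammingDist u y),
          (2 : ℝ) ^ (c * (isolation (S.filter fun y => p (y i)) V y : ℝ)) ≤
        ∑ y ∈ (S.filter fun y => h ≤ hammingDist u y).filter (fun y => p (y i)),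
          (2 : ℝ) ^ (c * (isolation S U y : ℝ)) := by
      intro p _
      rw [Finset.filter_comm]
      refine Finset.sum_le_sum fun y hy => ?_
      refine Real.rpow_le_rpow_of_exponent_le (by norm_num) (mul_le_mul_of_nonneg_left ?_ hc0)
      exact_mod_cast hiso p y (Finset.mem_filter.1 hy).2
    have hz₁ : z ∈ S₁ := Finset.mem_filter.2 ⟨hz, rfl⟩
    have hsplit := Finset.sum_filter_add_sum_filter_not
      (S.filter fun y => h ≤ hammingDist u y) (fun y => y i = z i)
      fun y => (2 : ℝ) ^ (c * (isolation S U y : ℝ))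
    rw [← hsplit]
    have hoff₁ : ∀ y ∈ S₁, ∀ j, j ∉ V → y j = z j := by
      intro y hy j hj
      rw [Finset.mem_filter] at hy
      by_cases hji : j = i
      · rw [hji]; exact hy.2
      · exact hoff y hy.1 j fun h => hj (Finset.mem_erase.2 ⟨hji, h⟩)
    have hb₁ := (ih V S₁ z h hVm hz₁ (fun y hy => hmax y (Finset.mem_filter.1 hy).1) hoff₁
      hh).trans (hsum fun b => b = z i)
    have hw : flip z i ∈ S₀ := Finset.mem_filter.2 ⟨hiS, by simp [flip]⟩
    -- The other half contains `flip z i`, so its farthest point `w` is at most one step closer to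
    -- `u` than `z`; as `h` is strictly below the distance of `z`, the threshold is still met.
    obtain ⟨w, hwS, hwmax⟩ := Finset.exists_max_image S₀ (fun y => hammingDist u y) ⟨_, hw⟩
    have hwz : w i = !z i := by
      have := (Finset.mem_filter.1 hwS).2
      revert this
      cases w i <;> cases z i <;> simp
    have hdw : hammingDist u z ≤ hammingDist u w + 1 := by
      have := hwmax _ hw
      have := (hammingDist_flip u z i).2 hiu
      omega
    have hoff₀ : ∀ y ∈ S₀, ∀ j, j ∉ V → y j = w j := by
      intro y hy j hj
      have hwS' := Finset.mem_filter.1 hwS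
      rw [Finset.mem_filter] at hy
      by_cases hji : j = i
      · rw [hji, hwz]
        have := hy.2
        revert this
        cases y i <;> cases z i <;> simp
      · have hjU : j ∉ U := fun h => hj (Finset.mem_erase.2 ⟨hji, h⟩)
        rw [hoff y hy.1 j hjU, hoff w hwS'.1 j hjU]
    have hb₀ := (ih V S₀ w h hVm hwS hwmax hoff₀ (by omega)).trans (hsum fun b => ¬ b = z i)
    -- Outside `V` the points `w` and `z` differ only at `i`, where `z` disagrees with `u` and `w`
    -- agrees.
    have hcount : (V.filter fun j => w j = u j).card + hammingDist u w + 1 =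
        (V.filter fun j => z j = u j).card + hammingDist u z := by
      rw [card_agree_add_hammingDist, card_agree_add_hammingDist, add_assoc]
      congr 1
      rw [← Finset.card_insert_of_notMem (a := i)]
      · congr 1
        ext j
        simp only [Finset.mem_insert, Finset.mem_filter, Finset.mem_compl]
        by_cases hji : j = i
        · simp [hji, hV, hiu.symm]
        · have hwS' := (Finset.mem_filter.1 hwS).1
          simp only [hji, false_or]
          refine and_congr_right fun hj => ?_
          rw [hoff w hwS' j fun h => hj (Finset.mem_erase.2 ⟨hji, h⟩)]
      · simp only [Finset.mem_filter, not_and, not_not]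
        intro _
        rw [hwz]
        revert hiu
        cases z i <;> cases u i <;> simp
    have hVU : (V.filter fun j => z j = u j) = U.filter fun j => z j = u j := by
      rw [hV, Finset.filter_erase, Finset.erase_eq_of_notMem]
      simp [hiu]
    rw [hVU] at hcount hb₁
    set a : ℝ := ((U.filter fun j => z j = u j).card : ℝ) with ha
    have hcount' : ((V.filter fun j => w j = u j).card : ℝ) + hammingDist u w + 1 =
        a + hammingDist u z := by rw [ha]; exact_mod_cast hcount
    have hdw' : (hammingDist u z : ℝ) ≤ hammingDist u w + 1 := by exact_mod_cast hdw
    refine le_trans ?_ (add_le_add hb₁ hb₀)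
    have hpow : (2 : ℝ) ^ (c * ((m + 1 : ℕ) : ℝ)) = 2 ^ c * 2 ^ (c * (m : ℝ)) := by
      rw [← Real.rpow_add (by norm_num)]
      congr 1
      push_cast
      ring
    rw [hpow]
    refine min_add_min (by positivity) (by positivity) ?_ ?_
    · have : (2 : ℝ) ^ (c * a + ((hammingDist u z : ℝ) - h)) / 2 =
          2 ^ (c * a + ((hammingDist u z : ℝ) - h) - 1) := by
        rw [Real.rpow_sub_one (by norm_num)]
      rw [this]
      refine Real.rpow_le_rpow_of_exponent_le (by norm_num) ?_
      -- Any distance lost beyond that of `z` minus one reappears as agreements, which are weighted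
      -- by `c`; any distance gained costs at most `c` per unit. As `c ≤ 1`, the exponent drops by
      -- at most 1.
      nlinarith [mul_nonneg (sub_nonneg.2 hc1) (sub_nonneg.2 hdw')]
    · calc (2 : ℝ) ^ c ≤ 2 ^ (1 : ℝ) := Real.rpow_le_rpow_of_exponent_le (by norm_num) hc1
        _ = 2 := Real.rpow_one 2

/-- The solutions that are almost as far from `u` as the farthest one have many isolated
directions, on the average. -/
theorem le_sum_isolation_far {k : ℕ} (hk : 1 ≤ k) (u : Fin n → Bool)
    {S : Finset (Fin n → Bool)} {z : Fin n → Bool} (hz : z ∈ S)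
    (hmax : ∀ y ∈ S, hammingDist u y ≤ hammingDist u z) :
    (2 : ℝ) ^ ((n : ℝ) / k - 1) ≤
      ∑ y ∈ S.filter (fun y => hammingDist u z - hammingDist u z / k ≤ hammingDist u y),
        (2 : ℝ) ^ ((isolation S Finset.univ y : ℝ) / k) := by
  have hk' : (1 : ℝ) ≤ k := by exact_mod_cast hk
  set r := hammingDist u z with hr
  have hrk : r / k ≤ r := Nat.div_le_self r k
  have h1 := le_sum_isolation (c := 1 / (k : ℝ)) (by positivity)
    (by rw [div_le_one (by linarith)]; exact hk') u n Finset.univ S z (r - r / k) (by simp) hz hmax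
    (fun y _ i hi => absurd (Finset.mem_univ i) hi) (Nat.sub_le _ _)
  have h2 := card_agree_add_hammingDist u z Finset.univ
  simp only [Finset.compl_univ, Finset.filter_empty, Finset.card_empty, add_zero,
    Finset.card_univ, Fintype.card_fin] at h2
  simp only [one_div_mul_eq_div] at h1
  refine le_trans (le_min ?_ ?_) h1
  · exact Real.rpow_le_rpow_of_exponent_le (by norm_num) (by linarith)
  -- The point `z` has `n - r` agreements and may lose `r / k` (rounded down) of its distance, so
  -- the exponent is `(n - r)/k + ⌊r/k⌋`; rounding costs the 1.
  · refine Real.rpow_le_rpow_of_exponent_le (by norm_num) ?_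
    have h3 : ((Finset.univ.filter fun i => z i = u i).card : ℝ) = n - r := by
      rw [eq_sub_iff_add_eq]
      exact_mod_cast h2
    have h4 : (r : ℝ) / k ≤ (r / k : ℕ) + 1 := by
      rw [div_le_iff₀ (by linarith)]
      have := Nat.lt_div_mul_add (a := r) (b := k) (by omega)
      have h5 : r ≤ (r / k + 1) * k := by linarith [add_mul (r / k) 1 k]
      exact_mod_cast h5
    rw [h3, Nat.cast_sub hrk, sub_div]
    linarith

end KSat

/-! ### Probabilities of events, and resampling one coordinate of a uniform bit vector -/

namespace PMF

variable {α β : Type}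

/-- The probability of an event. -/
noncomputable def prob (μ : PMF α) (p : α → Prop) : ℝ≥0∞ :=
  open Classical in μ.expect fun a => if p a then 1 else 0

theorem prob_mono (μ : PMF α) {p q : α → Prop} (h : ∀ a, p a → q a) : μ.prob p ≤ μ.prob q := by
  classical
  refine expect_mono μ fun a => ?_
  by_cases hp : p a
  · rw [if_pos hp, if_pos (h a hp)]
  · rw [if_neg hp]
    exact zero_le

theorem prob_or_le (μ : PMF α) (p q : α → Prop) :
    μ.prob (fun a => p a ∨ q a) ≤ μ.prob p + μ.prob q := by
  classical
  rw [prob, prob, prob, ← expect_add]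
  refine expect_mono μ fun a => ?_
  by_cases hp : p a <;> by_cases hq : q a <;> simp [hp, hq]

theorem prob_exists_le {ι : Type} (μ : PMF α) (s : Finset ι) (p : ι → α → Prop) :
    μ.prob (fun a => ∃ i ∈ s, p i a) ≤ ∑ i ∈ s, μ.prob (p i) := by
  classical
  simp only [prob]
  rw [← expect_finset_sum]
  refine expect_mono μ fun a => ?_
  split_ifs with h
  · obtain ⟨i, hi, hp⟩ := h
    refine le_trans ?_ (Finset.single_le_sum (fun _ _ => zero_le) hi)
    rw [if_pos hp]
  · exact zero_le

theorem prob_of_forall (μ : PMF α) {p : α → Prop} (h : ∀ a, p a) : μ.prob p = 1 := by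
  classical
  simp only [prob, h, if_true]
  exact expect_const μ 1

theorem prob_le_one (μ : PMF α) (p : α → Prop) : μ.prob p ≤ 1 :=
  (prob_mono μ fun _ _ => trivial).trans (prob_of_forall μ fun _ => trivial).le

theorem prob_map (μ : PMF α) (f : α → β) (p : β → Prop) :
    (μ.map f).prob p = μ.prob fun a => p (f a) := by
  rw [prob, expect_map]
  rfl

theorem prob_eq_apply (μ : PMF α) (a : α) : μ.prob (fun b => b = a) = μ a := by
  classical
  rw [prob, expect, tsum_eq_single a]
  · simp
  · intro b hb
    simp [hb]

theorem uniform_map_bijective [Fintype α] [Nonempty α] {f : α → α} (hf : Function.Bijective f) :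
    (uniformOfFintype α).map f = uniformOfFintype α := by
  classical
  ext b
  obtain ⟨a, rfl⟩ := hf.2 b
  rw [map_apply, tsum_eq_single a]
  · simp
  · intro a' ha'
    rw [if_neg fun h => ha' (hf.1 h.symm)]

/-- XOR with a fixed bit preserves uniformity, both for one coin and for one coordinate of the
vector. Replacing the value at `x` by its XOR with an independent coin passes from one side to the
other. -/
theorem uniform_eq_bind_update {ι : Type} [Fintype ι] [DecidableEq ι] (x : ι) :
    uniformOfFintype (ι → Bool) = (uniformOfFintype Bool).bind fun c =>
      (uniformOfFintype (ι → Bool)).map fun b => Function.update b x c := by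
  have h1 : ∀ c : Bool, Function.Bijective
      fun b : ι → Bool => Function.update b x (xor (b x) c) := fun c =>
    Function.Involutive.bijective fun b => by simp
  have h2 : ∀ d : Bool, Function.Bijective fun c : Bool => xor d c := fun d =>
    Function.Involutive.bijective fun c => by simp
  calc uniformOfFintype (ι → Bool)
      = (uniformOfFintype Bool).bind fun _ => uniformOfFintype (ι → Bool) :=
        (bind_const _ _).symm
    _ = (uniformOfFintype Bool).bind fun c => (uniformOfFintype (ι → Bool)).bind fun b =>
          PMF.pure (Function.update b x (xor (b x) c)) := by
        congr 1
        funext c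
        conv_lhs => rw [← uniform_map_bijective (h1 c), ← bind_pure_comp]
        rfl
    _ = (uniformOfFintype (ι → Bool)).bind fun b =>
          ((uniformOfFintype Bool).map fun c => xor (b x) c).bind fun c =>
            PMF.pure (Function.update b x c) := by
        rw [bind_comm]
        congr 1
        funext b
        rw [← bind_pure_comp, bind_bind]
        congr 1
        funext c
        rw [Function.comp, pure_bind]
    _ = _ := by
        simp only [uniform_map_bijective (h2 _)]
        rw [bind_comm]
        congr 1

end PMF

namespace RandWhile

variable {n : ℕ}

/-! ### The distribution of the shuffled list -/

/-- Move the entries with `b x` to the end. -/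
def partition (b : Fin n → Bool) (l : List (Fin n)) : List (Fin n) :=
  l.filter (fun x => !b x) ++ l.filter b

theorem partition_perm (b : Fin n → Bool) (l : List (Fin n)) : (partition b l).Perm l :=
  List.perm_append_comm.trans (List.filter_append_perm b l)

/-- Since no entry is repeated, the successive coins can be read as distinct coordinates of one
uniform vector indexed by the variables. -/
theorem foldl_splitPMF {l : List (Fin n)} (hl : l.Nodup) (p : List (Fin n) × List (Fin n)) :
    PMF.foldl splitPMF l p = (PMF.uniformOfFintype (Fin n → Bool)).map fun b =>
      ((l.filter b).reverse ++ p.1, (l.filter fun x => !b x).reverse ++ p.2) := by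
  induction l generalizing p with
  | nil =>
    simp only [PMF.foldl, List.filter_nil, List.reverse_nil, List.nil_append]
    exact (PMF.map_const _ _).symm
  | cons x l ih =>
    rw [List.nodup_cons] at hl
    rw [PMF.uniform_eq_bind_update x, PMF.map_bind, PMF.foldl, splitPMF, PMF.bind_map]
    congr 1
    funext c
    rw [Function.comp, ih hl.2, PMF.map_comp]
    congr 1
    funext b
    have h1 : l.filter (Function.update b x c) = l.filter b := List.filter_congr fun y hy => by
      rw [Function.update_of_ne (by rintro rfl; exact hl.1 hy)]
    have h2 : (l.filter fun y => !Function.update b x c y) = l.filter fun y => !b y :=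
      List.filter_congr fun y hy => by
        rw [Function.update_of_ne (by rintro rfl; exact hl.1 hy)]
    simp only [Function.comp, List.filter_cons, h1, h2, Function.update_self]
    cases c <;> simp

theorem roundPMF_eq {l : List (Fin n)} (hl : l.Nodup) :
    roundPMF l = (PMF.uniformOfFintype (Fin n → Bool)).map fun b => partition b l := by
  rw [roundPMF, foldl_splitPMF hl, PMF.map_comp]
  congr 1
  funext b
  simp [partition]

/-- The coins of `t` rounds, the last round first. -/
noncomputable def coins (n : ℕ) : ℕ → PMF (List (Fin n → Bool))
  | 0 => PMF.pure []
  | t + 1 => (coins n t).bind fun L => (PMF.uniformOfFintype (Fin n → Bool)).map fun b => b :: L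

/-- The order after rounds with the coins in `L`. -/
def order (L : List (Fin n → Bool)) : List (Fin n) := L.foldr partition (List.finRange n)

theorem order_perm (L : List (Fin n → Bool)) : (order L).Perm (List.finRange n) := by
  induction L with
  | nil => exact List.Perm.refl _
  | cons b L ih => exact (partition_perm b _).trans ih

theorem order_nodup (L : List (Fin n → Bool)) : (order L).Nodup :=
  (order_perm L).nodup_iff.2 (List.nodup_finRange n)

theorem mem_order (L : List (Fin n → Bool)) (i : Fin n) : i ∈ order L :=
  (order_perm L).mem_iff.2 (List.mem_finRange i)

theorem shufflePMF_eq (n : ℕ) : shufflePMF n = (coins n n).map order := by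
  have : ∀ t, PMF.foldl (fun _ : Unit => roundPMF) (List.replicate t ()) (List.finRange n) =
      (coins n t).map order := by
    intro t
    induction t with
    | zero => rw [coins, PMF.pure_map]; rfl
    | succ t ih =>
      rw [List.replicate_succ, PMF.foldl_const_succ, ih, PMF.bind_map, coins, PMF.map_bind]
      congr 1
      funext L
      rw [Function.comp, roundPMF_eq (order_nodup L), PMF.map_comp]
      rfl
  exact this n

/-- The coins of a variable. -/
def key (L : List (Fin n → Bool)) (i : Fin n) : List Bool := L.map fun b => b i

/-- Repeated stable partition is radix sort, the last round being the most significant: if it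
separates the two variables, it decides; otherwise it preserves their previous order. -/
theorem sublist_order {L : List (Fin n → Bool)} {i j : Fin n} (h : key L j < key L i) :
    [j, i].Sublist (order L) := by
  induction L with
  | nil => exact absurd h (lt_irrefl _)
  | cons b L ih =>
    rw [key, key, List.map_cons, List.map_cons, List.cons_lt_cons_iff] at h
    rw [order, List.foldr_cons, partition]
    rcases h with h | ⟨h1, h2⟩
    · rw [Bool.lt_iff] at h
      refine List.Sublist.append (l₁ := [j]) (r₁ := [i]) ?_ ?_
      · rw [List.singleton_sublist, List.mem_filter]
        exact ⟨mem_order L j, by simp [h.1]⟩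
      · rw [List.singleton_sublist, List.mem_filter]
        exact ⟨mem_order L i, h.2⟩
    · have h3 := ih h2
      cases hb : b i
      · refine List.Sublist.trans ?_ (List.sublist_append_left _ _)
        have := h3.filter fun x => !b x
        rwa [List.filter_cons_of_pos (by simp [h1, hb]),
          List.filter_cons_of_pos (by simp [hb])] at this
      · refine List.Sublist.trans ?_ (List.sublist_append_right _ _)
        have := h3.filter b
        rwa [List.filter_cons_of_pos (by simp [h1, hb]),
          List.filter_cons_of_pos (by simp [hb])] at this

/-- The keys of the variables are exchangeable, because a permutation of the coordinates preserves
each uniform round. -/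
theorem coins_map_comp (t : ℕ) (σ : Equiv.Perm (Fin n)) :
    (coins n t).map (fun L => L.map fun b => b ∘ σ) = coins n t := by
  induction t with
  | zero => rw [coins, PMF.pure_map]; rfl
  | succ t ih =>
    have hσ : Function.Bijective fun b : Fin n → Bool => b ∘ σ :=
      (Equiv.arrowCongr σ.symm (Equiv.refl Bool)).bijective
    conv_rhs => rw [coins, ← ih, PMF.bind_map]
    rw [coins, PMF.map_bind]
    congr 1
    funext L
    change ((PMF.uniformOfFintype (Fin n → Bool)).map fun b => b :: L).map _ =
      (PMF.uniformOfFintype (Fin n → Bool)).map _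
    conv_rhs => rw [← PMF.uniform_map_bijective hσ, PMF.map_comp]
    rw [PMF.map_comp]
    rfl

/-- In each round, given all other coins, the coin of `i` matches that of `j` with probability 1/2.
-/
theorem prob_key_eq_le {i j : Fin n} (hij : i ≠ j) (t : ℕ) :
    (coins n t).prob (fun L => key L i = key L j) ≤ 2⁻¹ ^ t := by
  classical
  induction t with
  | zero => simpa using PMF.prob_le_one _ _
  | succ t ih =>
    rw [PMF.prob, coins, PMF.expect_bind, pow_succ]
    refine le_trans ?_ (mul_le_mul_left ih _)
    rw [mul_comm, PMF.prob, ← PMF.expect_const_mul]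
    refine PMF.expect_mono _ fun L => ?_
    rw [PMF.expect_map, PMF.uniform_eq_bind_update i, PMF.expect_bind, PMF.expect_coin,
      PMF.expect_map, PMF.expect_map, ← PMF.expect_add]
    refine mul_le_mul_right ?_ _
    refine le_trans (PMF.expect_mono _ fun b => ?_)
      (PMF.expect_const (PMF.uniformOfFintype (Fin n → Bool)) _).le
    have h : ∀ c : Bool, key (Function.update b i c :: L) i = key (Function.update b i c :: L) j ↔
        c = b j ∧ key L i = key L j := fun c => by
      simp [key, Function.update_of_ne hij.symm]
    simp only [h]
    by_cases hL : key L i = key L j <;> cases b j <;> simp [hL]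

/-- In a random order, each entry of a set is the last one with almost the same probability. -/
theorem one_le_card_mul_prob_last (C : Finset (Fin n)) {i : Fin n} (hi : i ∈ C) :
    1 ≤ (C.card : ℝ≥0∞) * ((shufflePMF n).prob
      (fun l => ∀ j ∈ C, j ≠ i → [j, i].Sublist l) + C.card * 2⁻¹ ^ n) := by
  classical
  set W : Fin n → List (Fin n → Bool) → Prop := fun i L => ∀ j ∈ C, key L j ≤ key L i with hW
  -- By exchangeability all members of `C` are equally likely to have a maximal key; some member
  -- always has one. The error term comes from ties, where the keys do not determine the order.
  have hsymm : ∀ j ∈ C, (coins n n).prob (W j) = (coins n n).prob (W i) := by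
    intro j hj
    conv_lhs => rw [← coins_map_comp n (Equiv.swap i j), PMF.prob_map]
    congr 1
    funext L
    have hkey : ∀ x, key (L.map fun b => b ∘ Equiv.swap i j) x = key L (Equiv.swap i j x) :=
      fun x => by simp [key]
    simp only [hW, hkey, Equiv.swap_apply_right, eq_iff_iff]
    have hC : ∀ x ∈ C, Equiv.swap i j x ∈ C := fun x hx => by
      rw [Equiv.swap_apply_def]
      split_ifs <;> assumption
    exact ⟨fun h x hx => by simpa using h _ (hC x hx), fun h x hx => h _ (hC x hx)⟩
  have hsum : 1 ≤ (C.card : ℝ≥0∞) * (coins n n).prob (W i) := by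
    calc (1 : ℝ≥0∞) = (coins n n).prob fun L => ∃ j ∈ C, W j L :=
          (PMF.prob_of_forall _ fun L => C.exists_max_image (key L) ⟨i, hi⟩).symm
      _ ≤ ∑ j ∈ C, (coins n n).prob (W j) := PMF.prob_exists_le _ _ _
      _ = _ := by rw [Finset.sum_congr rfl hsymm, Finset.sum_const, nsmul_eq_mul]
  refine hsum.trans (mul_le_mul_right ?_ _)
  rw [shufflePMF_eq, PMF.prob_map]
  calc (coins n n).prob (W i)
      ≤ (coins n n).prob fun L => (∀ j ∈ C, j ≠ i → [j, i].Sublist (order L)) ∨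
          ∃ j ∈ C.erase i, key L i = key L j := by
        refine PMF.prob_mono _ fun L hL => ?_
        by_cases h : ∃ j ∈ C.erase i, key L i = key L j
        · exact Or.inr h
        · push Not at h
          exact Or.inl fun j hj hji => sublist_order
            ((hL j hj).lt_of_ne (h j (Finset.mem_erase.2 ⟨hji, hj⟩)).symm)
    _ ≤ _ := PMF.prob_or_le _ _ _
    _ ≤ _ := by
        refine add_le_add le_rfl ((PMF.prob_exists_le _ _ _).trans ?_)
        refine (Finset.sum_le_card_nsmul _ _ (2⁻¹ ^ n) fun j hj =>
          prob_key_eq_le (Finset.ne_of_mem_erase hj).symm n).trans ?_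
        rw [nsmul_eq_mul]
        exact mul_le_mul_left (by exact_mod_cast Finset.card_le_card (Finset.erase_subset _ _)) _

end RandWhile

/-! ### Jensen's inequality for powers of two -/

namespace PMF

variable {α : Type}

theorem prob_eq (μ : PMF α) (p : α → Prop) [DecidablePred p] :
    μ.prob p = μ.expect fun a => if p a then 1 else 0 := by
  rw [prob]
  congr
  funext a
  congr

/-- The convex function `2 ^ x` lies above its tangent at `m`, which has slope `c`. For `m ≤ 0` the
hypothesis is void, but then `2 ^ m ≤ 1`. -/
theorem ofReal_two_rpow_le_expect (μ : PMF α) (X : α → ℕ) {m : ℝ}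
    (h : ENNReal.ofReal m ≤ μ.expect fun a => (X a : ℝ≥0∞)) :
    ENNReal.ofReal (2 ^ m) ≤ μ.expect fun a => 2 ^ X a := by
  rcases le_total m 0 with hm | hm
  · calc ENNReal.ofReal (2 ^ m) ≤ 1 := by
          rw [← ENNReal.ofReal_one]
          exact ENNReal.ofReal_le_ofReal (Real.rpow_le_one_of_one_le_of_nonpos (by norm_num) hm)
      _ = μ.expect fun _ => 1 := (expect_const μ 1).symm
      _ ≤ _ := expect_mono μ fun a => one_le_pow₀ (by norm_num)
  set c : ℝ := 2 ^ m * Real.log 2 with hc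
  have hlog : 0 ≤ Real.log 2 := Real.log_nonneg (by norm_num)
  have hc0 : 0 ≤ c := by positivity
  have hreal : ∀ x : ℕ, (2 : ℝ) ^ m + c * x ≤ 2 ^ x + c * m := by
    intro x
    have h1 : (2 : ℝ) ^ x = 2 ^ m * Real.exp (Real.log 2 * (x - m)) := by
      rw [← Real.rpow_def_of_pos (by norm_num), ← Real.rpow_add (by norm_num),
        ← Real.rpow_natCast]
      congr 1
      ring
    have h2 := mul_le_mul_of_nonneg_left (Real.add_one_le_exp (Real.log 2 * ((x : ℝ) - m)))
      (show (0 : ℝ) ≤ 2 ^ m by positivity)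
    rw [h1, hc]
    linarith
  have hpt : ∀ x : ℕ, ENNReal.ofReal (2 ^ m) + ENNReal.ofReal c * x ≤
      2 ^ x + ENNReal.ofReal c * ENNReal.ofReal m := by
    intro x
    have := ENNReal.ofReal_le_ofReal (hreal x)
    rwa [ENNReal.ofReal_add (by positivity) (by positivity),
      ENNReal.ofReal_add (by positivity) (by positivity), ENNReal.ofReal_mul hc0,
      ENNReal.ofReal_mul hc0, ENNReal.ofReal_natCast, ENNReal.ofReal_pow (by norm_num),
      ENNReal.ofReal_ofNat] at this
  have hE := expect_mono μ fun a => hpt (X a)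
  rw [expect_add, expect_add, expect_const, expect_const, expect_const_mul] at hE
  refine (ENNReal.add_le_add_iff_right (a := ENNReal.ofReal c * ENNReal.ofReal m)
    (by finiteness)).1 (le_trans ?_ hE)
  exact add_le_add le_rfl (mul_le_mul_right h _)

end PMF

namespace RandWhile

variable {n : ℕ}

open KSat

/-! ### The success probability of a trial -/

/-- The restriction of `z` to the variables in a list. -/
def restrict (z : Fin n → Bool) (l : List (Fin n)) (i : Fin n) : Option Bool :=
  if i ∈ l then some (z i) else none

theorem update_restrict (z : Fin n → Bool) (l : List (Fin n)) (x : Fin n) :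
    Function.update (restrict z l) x (some (z x)) = restrict z (l ++ [x]) := by
  funext i
  by_cases h : i = x
  · subst h; simp [restrict]
  · simp [restrict, h]

theorem falsifies_restrict {F : Std.Sat.CNF (Fin n)} {z : Fin n → Bool} (hz : F.eval z = true)
    (l : List (Fin n)) : falsifies F (restrict z l) = false := by
  rw [falsifies, List.any_eq_false]
  intro C hC
  rw [Std.Sat.CNF.eval, ← Array.all_toList, List.all_eq_true] at hz
  have h := hz C hC
  rw [Std.Sat.CNF.Clause.eval, List.any_eq_true] at h
  obtain ⟨⟨i, b⟩, hl, hb⟩ := h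
  rw [List.all_eq_true]
  intro hall
  have h1 := hall _ hl
  simp only [beq_iff_eq] at h1 hb
  rw [restrict] at h1
  split_ifs at h1
  rw [Option.some.injEq, hb] at h1
  exact absurd h1.symm (Bool.not_ne_self b)

/-- After the variables in `l`, the value `z x` is forced by a unit clause. -/
def Forced (F : Std.Sat.CNF (Fin n)) (z : Fin n → Bool) (l : List (Fin n)) (x : Fin n) : Prop :=
  ∃ C ∈ F.clauses.toList, ∀ a ∈ C, (a.1 = x ∧ a.2 = z x) ∨ (a.1 ≠ x ∧ a.1 ∈ l ∧ a.2 = !z a.1)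

theorem Forced.falsifies {F : Std.Sat.CNF (Fin n)} {z : Fin n → Bool} {l : List (Fin n)}
    {x : Fin n} (h : Forced F z l x) :
    falsifies F (Function.update (restrict z l) x (some (!z x))) = true := by
  obtain ⟨C, hC, h⟩ := h
  rw [RandWhile.falsifies, List.any_eq_true]
  refine ⟨C, hC, ?_⟩
  rw [List.all_eq_true]
  rintro ⟨i, b⟩ ha
  rcases h _ ha with ⟨h1, h2⟩ | ⟨h1, h2, h3⟩
  · simp only at h1 h2
    simp [h1, h2]
  · simp only at h1 h2 h3
    simp [h1, h2, h3, restrict]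

/-- A coin equal to `z x` is kept, since a restriction of a solution falsifies no clause. A wrong
coin is corrected if the variable is forced. So the trial keeps following `z` with probability 1 in
the forced case and at least 1/2 in general. -/
theorem le_expect_assignPMF {F : Std.Sat.CNF (Fin n)} {z : Fin n → Bool} (hz : F.eval z = true)
    (l : List (Fin n)) (x : Fin n) (p : Prop) [Decidable p] (hp : p → Forced F z l x)
    (g : (Fin n → Option Bool) → ℝ≥0∞) :
    2⁻¹ * (if p then 2 else 1) * g (restrict z (l ++ [x])) ≤
      (assignPMF F x (restrict z l)).expect g := by
  rw [assignPMF, PMF.expect_map, PMF.expect_coin]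
  set γ : Bool → ℝ≥0∞ := fun b => g (if falsifies F (Function.update (restrict z l) x (some b))
    then Function.update (restrict z l) x (some (!b))
    else Function.update (restrict z l) x (some b)) with hγ
  have h1 : γ (z x) = g (restrict z (l ++ [x])) := by
    simp only [hγ]
    rw [update_restrict, falsifies_restrict hz, if_neg (by simp)]
  have h2 : p → γ (!z x) = g (restrict z (l ++ [x])) := fun hp' => by
    simp only [hγ]
    rw [(hp hp').falsifies, if_pos rfl, Bool.not_not, update_restrict]
  have h3 : γ true + γ false = γ (z x) + γ (!z x) := by
    cases z x
    · exact add_comm _ _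
    · rfl
  change _ ≤ 2⁻¹ * (γ true + γ false)
  rw [mul_assoc, h3, h1]
  refine mul_le_mul_right ?_ _
  by_cases hp' : p
  · rw [if_pos hp', h2 hp', two_mul]
  · rw [if_neg hp', one_mul]
    exact le_self_add

theorem le_expect_foldl_assignPMF {F : Std.Sat.CNF (Fin n)} {z : Fin n → Bool}
    (hz : F.eval z = true) (G : Finset (Fin n)) (g : (Fin n → Option Bool) → ℝ≥0∞)
    (post : List (Fin n)) : ∀ pre : List (Fin n),
    (∀ i ∈ G, ∀ l l', pre ++ post = l ++ i :: l' → Forced F z l i) →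
    (post.map fun x => 2⁻¹ * (if x ∈ G then 2 else 1)).prod * g (restrict z (pre ++ post)) ≤
      (PMF.foldl (assignPMF F) post (restrict z pre)).expect g := by
  induction post with
  | nil => intro pre _; simp [PMF.foldl, PMF.expect_pure]
  | cons x post ih =>
    intro pre hG
    rw [PMF.foldl, PMF.expect_bind, List.map_cons, List.prod_cons, mul_assoc]
    have h1 := ih (pre ++ [x]) (by simpa using hG)
    rw [List.append_assoc, List.singleton_append] at h1
    refine (mul_le_mul_right h1 _).trans ?_
    exact le_expect_assignPMF hz pre x (x ∈ G) (fun hx => hG x hx pre post rfl)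
      fun α => (PMF.foldl (assignPMF F) post α).expect g

theorem le_prob_foldl_assignPMF {F : Std.Sat.CNF (Fin n)} {z : Fin n → Bool}
    (hz : F.eval z = true) (G : Finset (Fin n)) {l : List (Fin n)}
    (hl : l.Perm (List.finRange n))
    (hG : ∀ i ∈ G, ∀ l₁ l₂, l = l₁ ++ i :: l₂ → Forced F z l₁ i) :
    2⁻¹ ^ n * 2 ^ G.card ≤
      (PMF.foldl (assignPMF F) l fun _ => none).prob fun α => α = fun i => some (z i) := by
  classical
  have h := le_expect_foldl_assignPMF hz G (fun α => if α = fun i => some (z i) then 1 else 0) l []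
    (by simpa using hG)
  have h1 : restrict z [] = fun _ => none := by funext i; simp [restrict]
  have h2 : restrict z ([] ++ l) = fun i => some (z i) := by
    funext i
    simp [restrict, hl.mem_iff.2 (List.mem_finRange i)]
  rw [h1, h2, if_pos rfl, mul_one, (hl.map _).prod_eq, ← Fin.prod_univ_def,
    Finset.prod_mul_distrib, Finset.prod_const, Finset.card_univ, Fintype.card_fin,
    Finset.prod_ite_mem, Finset.univ_inter, Finset.prod_const] at h
  rwa [PMF.prob_eq]

theorem mem_solutions {F : Std.Sat.CNF (Fin n)} {z : Fin n → Bool} :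
    z ∈ solutions F ↔ F.eval z = true := by simp [solutions]

/-- A clause that is violated when the value of `i` is changed. -/
theorem exists_critical {F : Std.Sat.CNF (Fin n)} {z : Fin n → Bool} (hz : z ∈ solutions F)
    {i : Fin n} (hi : KSat.flip z i ∉ solutions F) :
    ∃ C ∈ F.clauses.toList, (∃ a ∈ C, a.1 = i) ∧
      ∀ a ∈ C, (a.1 = i ∧ a.2 = z i) ∨ (a.1 ≠ i ∧ a.2 = !z a.1) := by
  rw [mem_solutions, Std.Sat.CNF.eval, ← Array.all_toList] at hz hi
  rw [Bool.not_eq_true, List.all_eq_false] at hi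
  obtain ⟨C, hC, hi⟩ := hi
  have hz := List.all_eq_true.1 hz C hC
  rw [Bool.not_eq_true, Std.Sat.CNF.Clause.eval, List.any_eq_false] at hi
  rw [Std.Sat.CNF.Clause.eval, List.any_eq_true] at hz
  have hall : ∀ a ∈ C, (a.1 = i ∧ a.2 = z i) ∨ (a.1 ≠ i ∧ a.2 = !z a.1) := by
    rintro ⟨j, b⟩ ha
    have h := hi _ ha
    simp only [KSat.flip] at h ⊢
    by_cases hj : j = i
    · subst hj
      revert h
      cases b <;> cases z j <;> simp
    · rw [Function.update_of_ne hj] at h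
      revert h
      cases b <;> cases z j <;> simp [hj]
  refine ⟨C, hC, ?_, hall⟩
  obtain ⟨⟨j, b⟩, ha, hb⟩ := hz
  refine ⟨(j, b), ha, ?_⟩
  rcases hall _ ha with h | h
  · exact h.1
  · have := h.2
    revert this hb
    simp only
    cases b <;> cases z j <;> simp

/-- For an order `l`, the set `G l` collects the isolated variables that come last in a chosen
critical clause. They are forced, so `z` is output with probability at least `2 ^ (|G l| - n)`; the
expectation of `|G l|` is then bounded below and Jensen's inequality applied. -/
theorem le_ppzPMF {k : ℕ} {F : Std.Sat.CNF (Fin n)} (hk : 1 ≤ k) (hF : IsKCNF k F)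
    {z : Fin n → Bool} (hz : z ∈ solutions F) :
    2⁻¹ ^ n * ENNReal.ofReal (2 ^ ((isolation (solutions F) Finset.univ z : ℝ) / k - k)) ≤
      ppzPMF F fun i => some (z i) := by
  classical
  set I := Finset.univ.filter fun i => KSat.flip z i ∉ solutions F with hI
  have hcrit : ∀ i : Fin n, ∃ C, i ∈ I → C ∈ F.clauses.toList ∧ (∃ a ∈ C, a.1 = i) ∧
      ∀ a ∈ C, (a.1 = i ∧ a.2 = z i) ∨ (a.1 ≠ i ∧ a.2 = !z a.1) := by
    intro i
    by_cases hi : i ∈ I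
    · obtain ⟨C, h1, h2⟩ := exists_critical hz (Finset.mem_filter.1 hi).2
      exact ⟨C, fun _ => ⟨h1, h2⟩⟩
    · exact ⟨[], fun h => absurd h hi⟩
  choose C hC using hcrit
  set V : Fin n → Finset (Fin n) := fun i => ((C i).map Prod.fst).toFinset with hV
  set last : Fin n → List (Fin n) → Prop := fun i l => ∀ j ∈ V i, j ≠ i → [j, i].Sublist l
    with hlast
  set G : List (Fin n) → Finset (Fin n) := fun l => I.filter fun i => last i l with hG
  have hforced : ∀ l : List (Fin n), l.Nodup → ∀ i ∈ G l, ∀ l₁ l₂, l = l₁ ++ i :: l₂ →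
      Forced F z l₁ i := by
    rintro l hl i hi l₁ l₂ rfl
    obtain ⟨hiI, hil⟩ := Finset.mem_filter.1 hi
    obtain ⟨h1, -, h3⟩ := hC i hiI
    refine ⟨C i, h1, fun a ha => ?_⟩
    rcases h3 a ha with h | ⟨h4, h5⟩
    · exact Or.inl h
    refine Or.inr ⟨h4, ?_, h5⟩
    have hsub := hil a.1 (List.mem_toFinset.2 (List.mem_map_of_mem ha)) h4
    by_contra hnot
    have hi2 : i ∉ l₂ := by
      rw [List.nodup_append, List.nodup_cons] at hl
      exact hl.2.1.1
    -- If `a.1` did not occur before `i`, then among the entries equal to `a.1` or `i` the first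
    -- would be `i`, with no second `i` behind it; this contradicts `[a.1, i]` being a sublist.
    have h6 : (l₁ ++ i :: l₂).filter (fun x => x = a.1 ∨ x = i) =
        i :: l₂.filter (fun x => x = a.1 ∨ x = i) := by
      rw [List.filter_append, List.filter_cons_of_pos (by simp), List.filter_eq_nil_iff.2,
        List.nil_append]
      intro x hx
      have h7 : x ≠ a.1 := by rintro rfl; exact hnot hx
      have h8 : x ≠ i := by
        rintro rfl
        exact (List.nodup_append.1 hl).2.2 x hx x (by simp) rfl
      simp [h7, h8]
    have h9 := hsub.filter fun x => x = a.1 ∨ x = i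
    rw [h6, List.filter_cons_of_pos (by simp), List.filter_cons_of_pos (by simp)] at h9
    rw [List.cons_sublist_cons'] at h9
    rcases h9 with h9 | ⟨h9, -⟩
    · exact hi2 (List.mem_of_mem_filter (h9.subset (by simp)))
    · exact h4 h9
  have hprob : ∀ i ∈ I, (k : ℝ≥0∞)⁻¹ ≤ (shufflePMF n).prob (last i) + k * 2⁻¹ ^ n := by
    intro i hi
    obtain ⟨h1, ⟨a, ha, hai⟩, -⟩ := hC i hi
    have hcard : (V i).card ≤ k := by
      refine (List.toFinset_card_le _).trans ?_
      rw [List.length_map]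
      exact hF _ (by simpa using h1)
    have hmem : i ∈ V i := List.mem_toFinset.2 (List.mem_map.2 ⟨a, ha, hai⟩)
    have hcard' : ((V i).card : ℝ≥0∞) ≤ k := by exact_mod_cast hcard
    have h := (one_le_card_mul_prob_last (V i) hmem).trans (mul_le_mul' hcard'
      (add_le_add le_rfl (mul_le_mul_left hcard' _)))
    rw [ENNReal.inv_le_iff_le_mul (by simp; omega) (by simp)]
    exact h
  have hexp : ENNReal.ofReal ((I.card : ℝ) / k - k) ≤
      (shufflePMF n).expect fun l => ((G l).card : ℝ≥0∞) := by
    have h1 : (shufflePMF n).expect (fun l => ((G l).card : ℝ≥0∞)) =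
        ∑ i ∈ I, (shufflePMF n).prob (last i) := by
      simp only [PMF.prob_eq]
      rw [← PMF.expect_finset_sum]
      congr 1
      funext l
      rw [hG, Finset.card_filter]
      push_cast
      rfl
    -- The tie errors add up to at most `|I| * k * 2 ^ (-n)`, which is at most `k` because `|I| ≤ n
    -- ≤ 2 ^ n`.
    have h2 : (I.card : ℝ≥0∞) * (k : ℝ≥0∞)⁻¹ ≤
        (∑ i ∈ I, (shufflePMF n).prob (last i)) + k := by
      have h3 := Finset.sum_le_sum hprob
      rw [Finset.sum_const, nsmul_eq_mul, Finset.sum_add_distrib, Finset.sum_const,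
        nsmul_eq_mul] at h3
      refine h3.trans (add_le_add le_rfl ?_)
      have h4 : (I.card : ℝ≥0∞) ≤ 2 ^ n := by
        have : I.card ≤ 2 ^ n := (Finset.card_le_univ I).trans
          (by rw [Fintype.card_fin]; exact Nat.lt_two_pow_self.le)
        exact_mod_cast this
      calc (I.card : ℝ≥0∞) * (k * 2⁻¹ ^ n) ≤ 2 ^ n * (k * 2⁻¹ ^ n) := mul_le_mul_left h4 _
        _ = k * (2 * 2⁻¹) ^ n := by rw [mul_pow]; ring
        _ = k := by rw [ENNReal.mul_inv_cancel (by simp) (by simp), one_pow, mul_one]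
    rw [h1, ENNReal.ofReal_sub _ (by positivity), ENNReal.ofReal_div_of_pos (by positivity),
      ENNReal.ofReal_natCast, ENNReal.ofReal_natCast, div_eq_mul_inv]
    exact tsub_le_iff_right.2 h2
  have hJ := PMF.ofReal_two_rpow_le_expect (shufflePMF n) (fun l => (G l).card) hexp
  calc 2⁻¹ ^ n * ENNReal.ofReal (2 ^ ((isolation (solutions F) Finset.univ z : ℝ) / k - k))
      ≤ 2⁻¹ ^ n * (shufflePMF n).expect fun l => 2 ^ (G l).card := mul_le_mul_right hJ _
    _ = (shufflePMF n).expect fun l => 2⁻¹ ^ n * 2 ^ (G l).card :=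
        (PMF.expect_const_mul _ _ _).symm
    _ ≤ (shufflePMF n).expect fun l =>
          (PMF.foldl (assignPMF F) l fun _ => none).prob fun α => α = fun i => some (z i) := by
        rw [shufflePMF_eq, PMF.expect_map, PMF.expect_map]
        exact PMF.expect_mono _ fun L => le_prob_foldl_assignPMF (mem_solutions.1 hz) _
          (order_perm L) (hforced _ (order_nodup L))
    _ = ppzPMF F fun i => some (z i) := by
        rw [← PMF.prob_eq_apply, ppzPMF, PMF.prob, PMF.expect_bind]
        rfl

/-- A trial finds a solution almost as far from `u` as the farthest one. -/
theorem le_prob_far {k : ℕ} {F : Std.Sat.CNF (Fin n)} (hk : 1 ≤ k) (hF : IsKCNF k F)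
    (u : Fin n → Bool) (hS : (solutions F).Nonempty) :
    ENNReal.ofReal (2 ^ ((n : ℝ) / k - 1 - k - n)) ≤ (ppzPMF F).prob fun α =>
      total α ∈ solutions F ∧ ∀ z ∈ solutions F,
        (1 - 1 / (k : ℝ)) * hammingDist u z ≤ hammingDist u (total α) := by
  classical
  have hk' : (1 : ℝ) ≤ k := by exact_mod_cast hk
  obtain ⟨z, hz, hmax⟩ := Finset.exists_max_image _ (fun y => hammingDist u y) hS
  have h1 := le_sum_isolation_far hk u hz hmax
  set r := hammingDist u z with hr
  set A := (solutions F).filter fun y => r - r / k ≤ hammingDist u y with hA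
  have hpow : ∀ x : ℝ, ENNReal.ofReal (2 ^ (x - k - n)) =
      2⁻¹ ^ n * ENNReal.ofReal (2 ^ (x - k)) := by
    intro x
    rw [Real.rpow_sub (by norm_num) (x - k) n, Real.rpow_natCast, div_eq_mul_inv, mul_comm,
      ENNReal.ofReal_mul (by positivity), ← inv_pow, ENNReal.ofReal_pow (by norm_num),
      ENNReal.ofReal_inv_of_pos (by norm_num), ENNReal.ofReal_ofNat]
  calc ENNReal.ofReal (2 ^ ((n : ℝ) / k - 1 - k - n))
      ≤ ENNReal.ofReal (∑ y ∈ A,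
          2 ^ ((isolation (solutions F) Finset.univ y : ℝ) / k - k - n)) := by
        refine ENNReal.ofReal_le_ofReal ?_
        simp only [sub_sub _ (k : ℝ) (n : ℝ)]
        simp only [Real.rpow_sub (show (0 : ℝ) < 2 by norm_num) _ ((k : ℝ) + n)]
        rw [← Finset.sum_div]
        exact div_le_div_of_nonneg_right h1 (by positivity)
    _ = ∑ y ∈ A, 2⁻¹ ^ n *
          ENNReal.ofReal (2 ^ ((isolation (solutions F) Finset.univ y : ℝ) / k - k)) := by
        rw [ENNReal.ofReal_sum_of_nonneg fun y _ => by positivity]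
        exact Finset.sum_congr rfl fun y _ => hpow _
    _ ≤ ∑ y ∈ A, (ppzPMF F).prob fun α => α = fun i => some (y i) := by
        refine Finset.sum_le_sum fun y hy => ?_
        rw [PMF.prob_eq_apply]
        exact le_ppzPMF hk hF (Finset.mem_filter.1 hy).1
    -- The events for different `y` are disjoint: the output determines `y`.
    _ ≤ (ppzPMF F).prob fun α => total α ∈ A := by
        simp only [PMF.prob_eq]
        rw [← PMF.expect_finset_sum]
        refine PMF.expect_mono _ fun α => ?_
        have htot : ∀ y, (α = fun i => some (y i)) → y = total α := by
          rintro y rfl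
          rfl
        calc (∑ y ∈ A, if α = fun i => some (y i) then (1 : ℝ≥0∞) else 0)
            ≤ ∑ y ∈ A, if y = total α then (1 : ℝ≥0∞) else 0 := by
              refine Finset.sum_le_sum fun y _ => ?_
              split_ifs with h2 h3 h3
              · exact le_rfl
              · exact absurd (htot y h2) h3
              · exact zero_le
              · exact le_rfl
          _ ≤ _ := by
              rw [Finset.sum_ite_eq']
    _ ≤ _ := by
        refine PMF.prob_mono _ fun α hα => ?_
        obtain ⟨h2, h3⟩ := Finset.mem_filter.1 hα
        refine ⟨h2, fun y hy => ?_⟩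
        have h4 : (hammingDist u y : ℝ) ≤ r := by exact_mod_cast hmax y hy
        have h5 : ((r - r / k : ℕ) : ℝ) ≤ hammingDist u (total α) := by exact_mod_cast h3
        have h6 : ((r / k : ℕ) : ℝ) ≤ r / k := Nat.cast_div_le
        rw [Nat.cast_sub (Nat.div_le_self r k)] at h5
        have h7 : 0 ≤ 1 - 1 / (k : ℝ) := by
          rw [sub_nonneg, div_le_one (by linarith)]
          exact hk'
        calc (1 - 1 / (k : ℝ)) * hammingDist u y ≤ (1 - 1 / (k : ℝ)) * r :=
              mul_le_mul_of_nonneg_left h4 h7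
          _ = r - r / k := by ring
          _ ≤ _ := by linarith

end RandWhile

namespace RandWhile

variable {n : ℕ}

open KSat

/-! ### The success probability of the algorithm -/

/-- `y` is a solution almost as far from `u` as the farthest one. -/
def Far (k : ℕ) (F : Std.Sat.CNF (Fin n)) (u y : Fin n → Bool) : Prop :=
  y ∈ solutions F ∧ ∀ z ∈ solutions F,
    (1 - 1 / (k : ℝ)) * hammingDist u z ≤ hammingDist u y

open Classical in
/-- A measure for what is still to be found. -/
noncomputable def potential (k : ℕ) (F : Std.Sat.CNF (Fin n)) :
    Option ((Fin n → Bool) × (Fin n → Bool)) → ℝ≥0∞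
  | none => 2
  | some z => if z.1 ∈ solutions F ∧ z.2 ∈ solutions F then if Far k F z.1 z.2 then 0 else 1 else ⊤

theorem potential_le_one {k : ℕ} {F : Std.Sat.CNF (Fin n)} {u y : Fin n → Bool}
    (hu : u ∈ solutions F) (hy : y ∈ solutions F) : potential k F (some (u, y)) ≤ 1 := by
  rw [potential, if_pos ⟨hu, hy⟩]
  split_ifs
  · exact zero_le
  · exact le_rfl

theorem potential_eq_zero {k : ℕ} {F : Std.Sat.CNF (Fin n)} {u y : Fin n → Bool}
    (hu : u ∈ solutions F) (hy : Far k F u y) : potential k F (some (u, y)) = 0 := by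
  rw [potential, if_pos ⟨hu, hy.1⟩, if_pos hy]

/-- A trial never increases the potential, and with probability at least `p` it decreases it by 1
unless it is already 0. The factor has `p / 2` because the potential starts at 2. -/
theorem expect_trialPMF_le {k : ℕ} {F : Std.Sat.CNF (Fin n)} {p : ℝ≥0∞}
    (hp : ∀ u, p ≤ (ppzPMF F).prob fun α => Far k F u (total α))
    (σ : Option ((Fin n → Bool) × (Fin n → Bool))) :
    (trialPMF F σ).expect (potential k F) ≤ (1 - p / 2) * potential k F σ := by
  classical
  have hp1 : p ≤ 1 := (hp fun _ => false).trans (PMF.prob_le_one _ _)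
  have hp2 : p / 2 ≤ p := ENNReal.half_le_self
  have hbound : ∀ (c : ℝ≥0∞) (u : Fin n → Bool), c ≠ ⊤ →
      (∀ y, potential k F (record F y σ) + (if Far k F u y then 1 else 0) ≤ c) →
      (trialPMF F σ).expect (potential k F) ≤ c - p := by
    intro c u hc h
    refine ENNReal.le_sub_of_add_le_right (ne_top_of_le_ne_top ENNReal.one_ne_top hp1) ?_
    rw [trialPMF, PMF.expect_map]
    refine (add_le_add le_rfl (hp u)).trans ?_
    rw [PMF.prob_eq, ← PMF.expect_add]
    exact (PMF.expect_mono _ fun α => h (total α)).trans (PMF.expect_const _ _).le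
  rcases σ with _ | ⟨u, y⟩
  -- As long as nothing is recorded any solution is progress, so the reference point is arbitrary.
  · refine (hbound 2 (fun _ => false) (by simp) fun y => ?_).trans ?_
    · rw [record]
      split_ifs with h1 h2 h2
      · have h3 := mem_solutions.2 h1
        calc _ ≤ (1 : ℝ≥0∞) + 1 := add_le_add (potential_le_one h3 h3) le_rfl
          _ = 2 := by norm_num
      · have h3 := mem_solutions.2 h1
        rw [add_zero]
        exact (potential_le_one h3 h3).trans (by norm_num)
      · exact absurd (mem_solutions.1 h2.1) h1
      · rw [add_zero]
        exact le_rfl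
    · rw [potential, ENNReal.sub_mul (fun _ _ => by simp), one_mul,
        ENNReal.div_mul_cancel (by simp) (by simp)]
  by_cases hσ : u ∈ solutions F ∧ y ∈ solutions F
  · by_cases hfar : Far k F u y
    · rw [potential_eq_zero hσ.1 hfar, mul_zero, trialPMF, PMF.expect_map]
      refine (PMF.expect_mono _ (h := fun _ => 0) fun α => ?_).trans (PMF.expect_const _ _).le
      rw [record]
      split_ifs with h
      · have h2 : (hammingDist u y : ℝ) ≤ hammingDist u (total α) := by exact_mod_cast h.2.le
        exact (potential_eq_zero hσ.1
          ⟨mem_solutions.2 h.1, fun z hz => (hfar.2 z hz).trans h2⟩).le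
      · exact (potential_eq_zero hσ.1 hfar).le
    · have h1 : potential k F (some (u, y)) = 1 := by rw [potential, if_pos hσ, if_neg hfar]
      rw [h1, mul_one]
      refine (hbound 1 u (by simp) fun x => ?_).trans (tsub_le_tsub_left hp2 1)
      rw [record]
      split_ifs with h2 h3 h3
      · rw [potential_eq_zero hσ.1 h3, zero_add]
      · rw [add_zero]
        exact potential_le_one hσ.1 (mem_solutions.2 h2.1)
      -- A far solution `x` that is not recorded would be no farther from `u` than `y`, and `y`
      -- would be far as well.
      · refine absurd ⟨hσ.2, fun z hz => (h3.2 z hz).trans ?_⟩ hfar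
        have : hammingDist u x ≤ hammingDist u y := by
          by_contra hlt
          exact h2 ⟨mem_solutions.1 h3.1, not_le.1 hlt⟩
        exact_mod_cast this
      · rw [add_zero, h1]
  · rw [potential, if_neg hσ, ENNReal.mul_top]
    · exact le_top
    · rw [Ne, tsub_eq_zero_iff_le, not_le]
      refine lt_of_le_of_lt (ENNReal.div_le_div_right hp1 2) ?_
      exact ENNReal.div_lt_of_lt_mul' (by norm_num)

theorem expect_trials_le {k : ℕ} {F : Std.Sat.CNF (Fin n)} {q : ℝ≥0∞}
    (hq : ∀ σ, (trialPMF F σ).expect (potential k F) ≤ q * potential k F σ) (N : ℕ) :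
    ∀ σ, (PMF.foldl (fun _ : Unit => trialPMF F) (List.replicate N ()) σ).expect (potential k F) ≤
      q ^ N * potential k F σ := by
  induction N with
  | zero => intro σ; simp [PMF.foldl, PMF.expect_pure]
  | succ N ih =>
    intro σ
    rw [List.replicate_succ, PMF.foldl, PMF.expect_bind]
    refine (PMF.expect_mono _ ih).trans ?_
    rw [PMF.expect_const_mul, pow_succ, mul_assoc]
    exact mul_le_mul_right (hq σ) _

/-- One endpoint of a diameter has distance at least half the diameter from `u`; the two bounds for
the endpoints are averaged. -/
theorem far_half_diam {k : ℕ} (hk : 1 ≤ k) {F : Std.Sat.CNF (Fin n)} {u y : Fin n → Bool}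
    (h : Far k F u y) :
    (1 / 2 : ℝ) * (1 - 1 / (k : ℝ)) * (((diam F).unbotD 0 : ℕ) : ℝ) ≤ hammingDist u y := by
  have hk' : (1 : ℝ) ≤ k := by exact_mod_cast hk
  have hc : 0 ≤ 1 - 1 / (k : ℝ) := by
    rw [sub_nonneg, div_le_one (by linarith)]
    exact hk'
  rcases hd : diam F with _ | d
  · change (1 / 2 : ℝ) * (1 - 1 / (k : ℝ)) * ((0 : ℕ) : ℝ) ≤ _
    rw [Nat.cast_zero, mul_zero]
    positivity
  · obtain ⟨p, hp, hpd⟩ := Finset.mem_image.1 (Finset.mem_of_max hd)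
    rw [Finset.mem_product] at hp
    have h1 := h.2 _ hp.1
    have h2 := h.2 _ hp.2
    have h3 : (d : ℝ) ≤ hammingDist u p.1 + hammingDist u p.2 := by
      rw [← hpd]
      have := hammingDist_triangle p.1 u p.2
      rw [hammingDist_comm p.1 u] at this
      exact_mod_cast this
    have h4 := mul_le_mul_of_nonneg_left h3 hc
    change (1 / 2 : ℝ) * (1 - 1 / (k : ℝ)) * (d : ℝ) ≤ _
    linarith

/-- The probability of failure. -/
noncomputable def failure (k n : ℕ) : ℝ := 2 * Real.exp (-((2 ^ (k + 2))⁻¹ * (n + 1)))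

theorem tendsto_failure (k : ℕ) : Tendsto (failure k) atTop (𝓝 0) := by
  have h1 : Tendsto (fun n : ℕ => ((2 : ℝ) ^ (k + 2))⁻¹ * (n + 1)) atTop atTop :=
    (tendsto_natCast_atTop_atTop.atTop_add tendsto_const_nhds).const_mul_atTop (by positivity)
  have h2 := (Real.tendsto_exp_neg_atTop_nhds_zero.comp h1).const_mul 2
  rwa [mul_zero] at h2

theorem two_rpow_le_trials (k n : ℕ) :
    ((n : ℝ) + 1) * 2 ^ ((n : ℝ) - n / k) ≤ trials k n := by
  rw [trials]
  push_cast
  refine mul_le_mul_of_nonneg_left ?_ (by positivity)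
  rw [← Real.rpow_natCast, Nat.cast_sub (Nat.div_le_self n k)]
  refine Real.rpow_le_rpow_of_exponent_le (by norm_num) ?_
  have : ((n / k : ℕ) : ℝ) ≤ n / k := Nat.cast_div_le
  linarith

theorem trials_le {k : ℕ} (hk : 1 ≤ k) (n : ℕ) :
    (trials k n : ℝ) ≤ ((n : ℝ) + 1) * (2 * 2 ^ ((n : ℝ) * (1 - 1 / (k : ℝ)))) := by
  rw [trials]
  push_cast
  refine mul_le_mul_of_nonneg_left ?_ (by positivity)
  have h2 : (2 : ℝ) * 2 ^ ((n : ℝ) * (1 - 1 / (k : ℝ))) =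
      2 ^ ((n : ℝ) * (1 - 1 / (k : ℝ)) + 1) := by
    rw [Real.rpow_add_one (by norm_num), mul_comm]
  rw [← Real.rpow_natCast, Nat.cast_sub (Nat.div_le_self n k), h2]
  refine Real.rpow_le_rpow_of_exponent_le (by norm_num) ?_
  have hk' : (0 : ℝ) < k := by exact_mod_cast hk
  have h4 : (n : ℝ) / k ≤ (n / k : ℕ) + 1 := by
    rw [div_le_iff₀ hk']
    have := Nat.lt_div_mul_add (a := n) (b := k) (by omega)
    have h5 : n ≤ (n / k + 1) * k := by linarith [add_mul (n / k) 1 k]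
    exact_mod_cast h5
  rw [mul_sub, mul_one, mul_one_div]
  linarith

/-- The success probability of a trial times the number of trials is at least `(n + 1) / 2 ^ (k +
1)`; the extra factor `n + 1` is what drives the failure probability to zero. -/
theorem failure_bound {k : ℕ} (hk : 1 ≤ k) (n : ℕ) :
    2 * (1 - ENNReal.ofReal (2 ^ ((n : ℝ) / k - 1 - k - n)) / 2) ^ trials k n ≤
      ENNReal.ofReal (failure k n) := by
  set P : ℝ := 2 ^ ((n : ℝ) / k - 1 - k - n) with hP
  have hP0 : 0 < P := by positivity
  have hk' : (1 : ℝ) ≤ k := by exact_mod_cast hk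
  have hP1 : P ≤ 1 := by
    refine Real.rpow_le_one_of_one_le_of_nonpos (by norm_num) ?_
    have : (n : ℝ) / k ≤ n := div_le_self (by positivity) hk'
    linarith
  have h1 : (1 - ENNReal.ofReal P / 2 : ℝ≥0∞) = ENNReal.ofReal (1 - P / 2) := by
    rw [ENNReal.ofReal_sub _ (by positivity), ENNReal.ofReal_one,
      ENNReal.ofReal_div_of_pos (by norm_num), ENNReal.ofReal_ofNat]
  have h2 : (1 - P / 2) ^ trials k n ≤ Real.exp (-((2 ^ (k + 2))⁻¹ * (n + 1))) := by
    calc (1 - P / 2) ^ trials k n ≤ Real.exp (-(P / 2)) ^ trials k n :=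
          pow_le_pow_left₀ (by linarith) (Real.one_sub_le_exp_neg _) _
      _ = Real.exp (-(P / 2 * trials k n)) := by
          rw [← Real.exp_nat_mul]
          congr 1
          ring
      _ ≤ _ := by
          refine Real.exp_le_exp.2 (neg_le_neg ?_)
          have h3 := mul_le_mul_of_nonneg_left (two_rpow_le_trials k n)
            (show 0 ≤ P / 2 by positivity)
          refine le_trans (le_of_eq ?_) h3
          have h4 : P * 2 ^ ((n : ℝ) - n / k) = (2 ^ (k + 1))⁻¹ := by
            rw [hP, ← Real.rpow_add (by norm_num), ← Real.rpow_natCast,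
              ← Real.rpow_neg (by norm_num)]
            congr 1
            push_cast
            ring
          calc ((2 : ℝ) ^ (k + 2))⁻¹ * (n + 1) = (2 ^ (k + 1))⁻¹ / 2 * (n + 1) := by
                rw [pow_succ _ (k + 1), mul_inv]
                ring
            _ = _ := by
                rw [← h4]
                ring
  rw [h1, ← ENNReal.ofReal_pow (by linarith), failure, ENNReal.ofReal_mul (by norm_num),
    ENNReal.ofReal_ofNat]
  exact mul_le_mul_right (ENNReal.ofReal_le_ofReal h2) _

/-! ### The running time -/

theorem mainTime_le (k n m : ℕ) :
    mainTime k n m ≤ (50 * k + 425) * (n + m + 1) ^ 3 * trials k n := by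
  obtain ⟨M, hM⟩ : ∃ M, M = n + m + 1 := ⟨_, rfl⟩
  have hn : n ≤ M := by omega
  have hm : m ≤ M := by omega
  have h1 : 1 ≤ M := by omega
  have hMM : M ≤ M ^ 2 := by nlinarith
  have hMMM : M ^ 2 ≤ M ^ 3 := Nat.pow_le_pow_right h1 (by omega)
  have hc : checkTime k n m ≤ (25 * k + 40) * M ^ 2 := by
    calc checkTime k n m ≤ M * (k * (25 * M) + 20) + 20 := by
          rw [checkTime]
          gcongr
          omega
      _ ≤ _ := by nlinarith
  have ha : assignTime k n m ≤ (25 * k + 160) * M ^ 2 := by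
    rw [assignTime]
    nlinarith
  have hs : shuffleTime n ≤ 67 * M ^ 2 := by
    calc shuffleTime n ≤ M * (20 * M + 23) + 4 * M + 20 := by
          rw [shuffleTime]
          gcongr
      _ ≤ _ := by nlinarith
  have ht : trialTime k n m ≤ (50 * k + 368) * M ^ 3 := by
    calc trialTime k n m ≤ 67 * M ^ 2 + M * ((25 * k + 160) * M ^ 2 + 1) +
          (25 * k + 40) * M ^ 2 + 30 * M + 70 := by
          rw [trialTime]
          gcongr
      _ = (25 * k + 160) * M ^ 3 + (25 * k + 107) * M ^ 2 + 31 * M + 70 := by ring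
      _ ≤ (25 * k + 160) * M ^ 3 + (25 * k + 107) * M ^ 3 + 31 * M ^ 3 + 70 * M ^ 3 := by
          have h2 := Nat.mul_le_mul_left (25 * k + 107) hMMM
          omega
      _ ≤ _ := by
          have : 0 ≤ k * M ^ 3 := Nat.zero_le _
          linarith
  have hN : 1 ≤ trials k n := by
    rw [trials]
    exact Nat.one_le_iff_ne_zero.2 (by positivity)
  rw [← hM]
  have hM3 : M ≤ M ^ 3 := hMM.trans hMMM
  have e1 : M * trials k n ≤ M ^ 3 * trials k n := Nat.mul_le_mul_right _ hM3
  have e2 : M ≤ M ^ 3 * trials k n := hM3.trans (Nat.le_mul_of_pos_right _ hN)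
  have e3 : trials k n ≤ M ^ 3 * trials k n := Nat.le_mul_of_pos_left _ (by positivity)
  calc mainTime k n m ≤ (M * (4 * trials k n + 20) + 20) +
        trials k n * ((50 * k + 368) * M ^ 3 + 3) + 10 := by
        rw [mainTime, counterTime]
        gcongr
    _ = (50 * k + 368) * M ^ 3 * trials k n + 4 * (M * trials k n) + 20 * M +
          3 * trials k n + 30 := by ring
    _ ≤ (50 * k + 368) * M ^ 3 * trials k n + 57 * (M ^ 3 * trials k n) := by omega
    _ = _ := by ring

end RandWhile

/-! ### The main theorem -/

theorem mainTheorem5 (k : ℕ) (hk : 1 ≤ k) :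
    ∃ (P : RandWhile.Prog) (A a : ℕ) (ε : ℕ → ℝ),
      Tendsto ε atTop (𝓝 0) ∧
      ∀ (n : ℕ) (F : Std.Sat.CNF (Fin n)), KSat.IsKCNF k F →
        ∃ T : ℕ,
          (T : ℝ) ≤ (A : ℝ) * ((n : ℝ) + (F.clauses.size : ℝ) + 1) ^ a *
              (2 : ℝ) ^ ((n : ℝ) * (1 - 1 / (k : ℝ))) ∧
          P.HaltsWithin (RandWhile.encodeFormula F) T ∧
          ((KSat.solutions F).Nonempty →
            ENNReal.ofReal (1 - ε n) ≤
              P.outputProb (RandWhile.encodeFormula F) T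
                {o | ∃ z₁ ∈ KSat.solutions F, ∃ z₂ ∈ KSat.solutions F,
                  o = RandWhile.encodePair z₁ z₂ ∧
                  (1 / 2 : ℝ) * (1 - 1 / (k : ℝ)) * ((((KSat.diam F).unbotD 0 : ℕ)) : ℝ) ≤
                    (hammingDist z₁ z₂ : ℝ)}) := by
  classical
  -- The factor 2 and the fourth power come from `trials_le`: rounding `n / k` costs 2, and the
  -- factor `n + 1` in the number of trials raises the cubic bound of `mainTime_le` by one degree.
  refine ⟨RandWhile.main k, 2 * (50 * k + 425), 4, RandWhile.failure k,
    RandWhile.tendsto_failure k, fun n F hF => ⟨RandWhile.mainTime k n F.clauses.size, ?_, ?_, ?_⟩⟩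
  · set m := F.clauses.size
    set X : ℝ := 2 ^ ((n : ℝ) * (1 - 1 / (k : ℝ))) with hX
    have hX0 : 0 ≤ X := by positivity
    have h1 : (RandWhile.mainTime k n m : ℝ) ≤
        (50 * k + 425) * ((n : ℝ) + m + 1) ^ 3 * RandWhile.trials k n := by
      exact_mod_cast RandWhile.mainTime_le k n m
    have h2 := RandWhile.trials_le hk n
    rw [← hX] at h2
    have h3 : ((n : ℝ) + 1) * (2 * X) ≤ ((n : ℝ) + m + 1) * (2 * X) :=
      mul_le_mul_of_nonneg_right (by linarith [(Nat.cast_nonneg m : (0 : ℝ) ≤ m)]) (by positivity)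
    calc (RandWhile.mainTime k n m : ℝ)
        ≤ (50 * k + 425) * ((n : ℝ) + m + 1) ^ 3 * (((n : ℝ) + m + 1) * (2 * X)) :=
          h1.trans (mul_le_mul_of_nonneg_left (h2.trans h3) (by positivity))
      _ = _ := by
          push_cast
          ring
  · exact (RandWhile.main_correct hk hF).1
  · intro hS
    refine le_trans ?_ ((RandWhile.main_correct hk hF).2 _)
    have h1 := RandWhile.expect_trials_le (RandWhile.expect_trialPMF_le
      fun u => RandWhile.le_prob_far hk hF u hS) (RandWhile.trials k n) none
    have h2 := h1.trans ((mul_comm _ _).le.trans (RandWhile.failure_bound hk n))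
    rw [ENNReal.ofReal_sub _ (by rw [RandWhile.failure]; positivity), ENNReal.ofReal_one]
    refine (tsub_le_tsub_left h2 1).trans (tsub_le_iff_right.2 ?_)
    -- The indicator of success plus the potential is at least 1 at every outcome, so the failure
    -- probability is at most the expected potential.
    rw [RandWhile.mainPMF, ← PMF.expect_add]
    refine (PMF.expect_const (PMF.foldl (fun _ : Unit => RandWhile.trialPMF F)
      (List.replicate (RandWhile.trials k n) ()) none) 1).ge.trans
      (PMF.expect_mono _ fun σ => ?_)
    rcases σ with _ | z
    · exact le_add_left (by rw [RandWhile.potential]; norm_num)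
    · rw [RandWhile.potential]
      by_cases hz : z.1 ∈ KSat.solutions F ∧ z.2 ∈ KSat.solutions F
      · by_cases hfar : RandWhile.Far k F z.1 z.2
        · rw [if_pos ⟨z, rfl, z.1, hz.1, z.2, hz.2, rfl, RandWhile.far_half_diam hk hfar⟩]
          exact le_self_add
        · rw [if_pos hz, if_neg hfar]
          exact le_add_self
      · rw [if_neg hz, add_top]
        exact le_top
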